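/- Let $B(q)=\sum_{n\ge 0} b_n q^n$ be a power series with non-negative real coefficients and radius of convergence at least $1$, and let $\lambda,\alpha,\beta,\gamma$ be real numbers with $\gamma>0$. Here $f\sim g$ means $f=(1+o(1))\,g$. Suppose that $$B(e^{-t})\sim \lambda\,\log\left(\tfrac1t\right)^{\alpha} t^{\beta} e^{\gamma/t}\qquad\text{as } t\to 0^+,$$ and that for every $\Delta>0$ $$B(e^{-z}) = O_\Delta\!\left(\log\left(\tfrac1{|z|}\right)^{\alpha}|z|^{\beta}e^{\gamma/|z|}\right)\qquad\text{as } z=x+iy\to 0 \text{ with } x>0,\ |y|\le \Delta x.$$ Then $$\sum_{n=0}^{N} b_n\sim \frac{\lambda\,\gamma^{\frac{\beta}{2}-\frac14}\,\log(N)^{\alpha}}{2^{\alpha+1}\sqrt{\pi}\,N^{\frac{\beta}{2}+\frac14}}\,e^{2\sqrt{\gamma N}}\qquad\text{as } N\to\infty.$$ Furthermore, if the $b_n$ are weakly increasing, then $$b_n\sim \frac{\lambda\,\gamma^{\frac{\beta}{2}+\frac14}\,\log(n)^{\alpha}}{2^{\alpha+1}\sqrt{\pi}\,n^{\frac{\beta}{2}+\frac34}}\,e^{2\sqrt{\gamma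 n}}\qquad\text{as } n\to\infty.$$ -/

import Mathlib

open Filter Topology Asymptotics

/-- The radius of convergence of the power series `∑ bₙ qⁿ` in the complex variable `q`. -/
noncomputable def radiusOfConvergence (b : ℕ → ℝ) : ENNReal :=
  (FormalMultilinearSeries.ofScalars ℂ (fun n => (b n : ℂ))).radius

/-- The function `B(q) = ∑_{n ≥ 0} bₙ qⁿ`. -/
noncomputable def genFun (b : ℕ → ℝ) (q : ℂ) : ℂ :=
  ∑' n : ℕ, (b n : ℂ) * q ^ n

/-- The region `x > 0`, `|y| ≤ Δ x` of the points `z = x + i y`. -/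
def cone (Δ : ℝ) : Set ℂ :=
  {z : ℂ | 0 < z.re ∧ |z.im| ≤ Δ * z.re}

/-!
The proof is a saddle point argument in probabilistic form. For `t > 0` choose `n` at random with
probability proportional to `bₙ e^{-nt}`, and let `saddleLaw b γ t` be the law of `nt - γ/t`; the
value `n = γ/t²` at the origin is the saddle point of `e^{γ/t + nt}`. Undoing the weights,
`∑_{n ≤ (γ/t + δ)/t} bₙ` equals `B(e^{-t}) e^{γ/t}` times the integral of `e^s` over `s ≤ δ` against
this law. It is therefore enough to know that, after division by `√t`, the law looks like a multiple
of Lebesgue measure on bounded scales: a local limit theorem.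

The two hypotheses supply exactly what such a theorem needs. The asymptotics of `B` on the real axis
give convergence of the moment generating functions at scale `√t` to `e^{γ v²}`, hence, by a
Vitali-type argument (`tendsto_zero_of_tendsto_zero_on_real`, `tendsto_charFun_of_tendsto_mgf`),
convergence of the characteristic functions to `e^{-γ w²}`. The bound in a cone gives a Gaussian
majorant `e^{-κ u²/t}` for the characteristic function on every bounded window
(`eventually_norm_genFun_le`), which is the domination needed to integrate that limit
(`tendsto_integral_mul_charFun`).

The passage from Fourier integrals to the measure itself uses a kernel with compactly supported
Fourier transform: the sum of a Fejér kernel and a translate of it, which has no zeros and decays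
only like `s⁻²`, so that it dominates `e^s` on `s ≤ δ`. Multiplied by this kernel, the rescaled laws
converge weakly by Lévy's theorem (`tendsto_integral_mul_fejerPair`), and a sandwich between
continuous cutoffs yields `tendsto_integral_indicator_exp`. At `t = √(γ/N)` and `δ = 0` this is the
claim on partial sums (`tendsto_partialSum_saddle`). For monotone coefficients the same statement
with arbitrary `δ` compares `b_N` with its average over windows of length `δ/t` next to `N`
(`tendsto_div_of_tendsto_partialSum`).

Non-negativity of the coefficients forces `lam ≥ 0`, and if `lam = 0` all coefficients vanish.
-/

/-! ### Convergence of bounded holomorphic functions -/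

lemma norm_dslope_le_of_norm_le {f : ℂ → ℂ} {R M : ℝ}
    (hd : DifferentiableOn ℂ f (Metric.ball 0 R)) (hb : ∀ z ∈ Metric.ball (0 : ℂ) R, ‖f z‖ ≤ M)
    {z : ℂ} (hz : z ∈ Metric.ball (0 : ℂ) R) : ‖dslope f 0 z‖ ≤ 2 * M / R := by
  have hR : 0 < R := Metric.pos_of_mem_ball hz
  refine Complex.norm_dslope_le_div_of_mapsTo_ball (hd := hd) (fun w hw => ?_) hz
  rw [Metric.mem_closedBall, dist_eq_norm]
  calc ‖f w - f 0‖ ≤ ‖f w‖ + ‖f 0‖ := norm_sub_le _ _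
    _ ≤ M + M := add_le_add (hb w hw) (hb 0 (Metric.mem_ball_self hR))
    _ = 2 * M := by ring

lemma differentiableOn_dslope_ball {f : ℂ → ℂ} {R : ℝ} (hR : 0 < R)
    (hd : DifferentiableOn ℂ f (Metric.ball 0 R)) :
    DifferentiableOn ℂ (dslope f 0) (Metric.ball 0 R) :=
  (Complex.differentiableOn_dslope (Metric.ball_mem_nhds 0 hR)).2 hd

/-- Subtracting the value at the origin and dividing by `z` preserves convergence to zero at real
points: at the origin itself it comes from the equicontinuity that Schwarz's lemma provides. -/
lemma tendsto_dslope_zero_of_tendsto_zero {f : ℕ → ℂ → ℂ} {R M : ℝ} (hR : 0 < R) (hM : 0 < M)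
    (hd : ∀ᶠ k in atTop, DifferentiableOn ℂ (f k) (Metric.ball 0 R))
    (hb : ∀ᶠ k in atTop, ∀ z ∈ Metric.ball (0 : ℂ) R, ‖f k z‖ ≤ M)
    (hx : ∀ x : ℝ, |x| < R → Tendsto (fun k => f k x) atTop (𝓝 0)) (x : ℝ) (hxR : |x| < R) :
    Tendsto (fun k => dslope (f k) 0 x) atTop (𝓝 0) := by
  have key : ∀ y : ℝ, |y| < R → y ≠ 0 →
      Tendsto (fun k => dslope (f k) 0 (y : ℂ)) atTop (𝓝 0) := by
    intro y hy hy0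
    have hyc : (y : ℂ) ≠ 0 := by exact_mod_cast hy0
    have h0 : Tendsto (fun k => f k 0) atTop (𝓝 0) := by simpa using hx 0 (by simpa using hR)
    have : Tendsto (fun k => (y : ℂ)⁻¹ * (f k y - f k 0)) atTop (𝓝 ((y : ℂ)⁻¹ * (0 - 0))) :=
      ((hx y hy).sub h0).const_mul _
    simp only [sub_zero, mul_zero] at this
    refine this.congr fun k => ?_
    rw [dslope_of_ne _ hyc, slope_def_field, sub_zero, div_eq_inv_mul]
  by_cases hx0 : x = 0
  swap
  · exact key x hxR hx0
  subst hx0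
  rw [Metric.tendsto_atTop']
  simp only [dist_zero_right]
  intro ε hε
  set K : ℝ := 2 * (2 * M / R) / R with hK
  have hKpos : 0 < K := by positivity
  set y : ℝ := min (R / 2) (ε / (2 * K)) with hy
  have hypos : 0 < y := lt_min (by positivity) (by positivity)
  have hyR : |y| < R := by
    rw [abs_of_pos hypos]; exact (min_le_left _ _).trans_lt (by linarith)
  have hyc : (y : ℂ) ∈ Metric.ball (0 : ℂ) R := by simpa using hyR
  have h1 := (Metric.tendsto_nhds.1 (key y hyR hypos.ne')) (ε / 2) (by positivity)
  obtain ⟨N, hN⟩ := eventually_atTop.1 ((hd.and hb).and h1)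
  refine ⟨N, fun k hk => ?_⟩
  obtain ⟨⟨hdk, hbk⟩, h1k⟩ := hN k hk.le
  rw [dist_zero_right] at h1k
  have h2 : ‖dslope (dslope (f k) 0) 0 (y : ℂ)‖ ≤ K :=
    norm_dslope_le_of_norm_le (differentiableOn_dslope_ball hR hdk)
      (fun z hz => norm_dslope_le_of_norm_le hdk hbk hz) hyc
  have h3 : dslope (f k) 0 (y : ℂ) - dslope (f k) 0 0 = y * dslope (dslope (f k) 0) 0 (y : ℂ) := by
    have := sub_smul_dslope (dslope (f k) 0) (0 : ℂ) (y : ℂ)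
    simpa using this.symm
  have h4 : dslope (f k) 0 ((0 : ℝ) : ℂ)
      = dslope (f k) 0 (y : ℂ) - y * dslope (dslope (f k) 0) 0 (y : ℂ) := by
    rw [← h3]; simp
  rw [h4]
  calc _ ≤ ‖dslope (f k) 0 (y : ℂ)‖ + ‖(y : ℂ) * dslope (dslope (f k) 0) 0 (y : ℂ)‖ :=
        norm_sub_le _ _
    _ < ε / 2 + y * K := by
        rw [norm_mul, Complex.norm_real, Real.norm_eq_abs, abs_of_pos hypos]
        exact add_lt_add_of_lt_of_le h1k (by gcongr)
    _ ≤ ε / 2 + ε / (2 * K) * K := by gcongr; exact min_le_right _ _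
    _ = ε := by field_simp; ring

/-- Splitting off the first `m` Taylor coefficients, each of which tends to zero, leaves `z ^ m` times
a remainder that Schwarz's lemma bounds by `(2 / R) ^ m * M`. -/
lemma eventually_norm_le_pow_of_tendsto_zero_on_real (m : ℕ) {R : ℝ} (hR : 0 < R) :
    ∀ {M : ℝ} (_ : 0 < M) {f : ℕ → ℂ → ℂ}
    (_ : ∀ᶠ k in atTop, DifferentiableOn ℂ (f k) (Metric.ball 0 R))
    (_ : ∀ᶠ k in atTop, ∀ z ∈ Metric.ball (0 : ℂ) R, ‖f k z‖ ≤ M)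
    (_ : ∀ x : ℝ, |x| < R → Tendsto (fun k => f k x) atTop (𝓝 0))
    {z : ℂ} (_ : z ∈ Metric.ball (0 : ℂ) R) {ε : ℝ} (_ : 0 < ε),
    ∀ᶠ k in atTop, ‖f k z‖ ≤ (2 * ‖z‖ / R) ^ m * M + ε := by
  induction m with
  | zero =>
    intro M hM f hd hb hx z hz ε hε
    filter_upwards [hb] with k hbk
    have := hbk z hz
    simp; linarith
  | succ m ih =>
    intro M hM f hd hb hx z hz ε hε
    have hg := ih (M := 2 * M / R) (by positivity) (f := fun k => dslope (f k) 0)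
      (by filter_upwards [hd] with k hk using differentiableOn_dslope_ball hR hk)
      (by filter_upwards [hd, hb] with k hk hbk w hw using norm_dslope_le_of_norm_le hk hbk hw)
      (fun x hxR => tendsto_dslope_zero_of_tendsto_zero hR hM hd hb hx x hxR) hz
      (ε := ε / (2 * R)) (by positivity)
    have h0 : Tendsto (fun k => f k 0) atTop (𝓝 0) := by simpa using hx 0 (by simpa using hR)
    have h1 := (Metric.tendsto_nhds.1 h0) (ε / 2) (by positivity)
    filter_upwards [hg, h1] with k hgk h1k
    rw [dist_zero_right] at h1k
    have h2 : f k z = f k 0 + z * dslope (f k) 0 z := by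
      have := sub_smul_dslope (f k) (0 : ℂ) z
      simp only [sub_zero, smul_eq_mul] at this
      rw [this]; ring
    have hzR : ‖z‖ < R := by simpa using hz
    rw [h2]
    calc _ ≤ ‖f k 0‖ + ‖z‖ * ‖dslope (f k) 0 z‖ := by
          rw [← norm_mul]; exact norm_add_le _ _
      _ ≤ ε / 2 + ‖z‖ * ((2 * ‖z‖ / R) ^ m * (2 * M / R) + ε / (2 * R)) := by gcongr
      _ = (2 * ‖z‖ / R) ^ (m + 1) * M + (ε / 2 + ‖z‖ * (ε / (2 * R))) := by ring
      _ ≤ (2 * ‖z‖ / R) ^ (m + 1) * M + (ε / 2 + R * (ε / (2 * R))) := by gcongr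
      _ = _ := by field_simp; ring

/-- A form of Vitali's theorem: uniformly bounded holomorphic functions on a disc that tend to zero
on its real diameter tend to zero on the disc with the same centre and half the radius. -/
theorem tendsto_zero_of_tendsto_zero_on_real {f : ℕ → ℂ → ℂ} {R M : ℝ} (hM : 0 < M)
    (hd : ∀ᶠ k in atTop, DifferentiableOn ℂ (f k) (Metric.ball 0 R))
    (hb : ∀ᶠ k in atTop, ∀ z ∈ Metric.ball (0 : ℂ) R, ‖f k z‖ ≤ M)
    (hx : ∀ x : ℝ, |x| < R → Tendsto (fun k => f k x) atTop (𝓝 0)) {z : ℂ} (hz : 2 * ‖z‖ < R) :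
    Tendsto (fun k => f k z) atTop (𝓝 0) := by
  have hR : 0 < R := lt_of_le_of_lt (by positivity) hz
  have hzb : z ∈ Metric.ball (0 : ℂ) R := by
    simp only [mem_ball_zero_iff]; nlinarith [norm_nonneg z]
  rw [Metric.tendsto_nhds]
  intro ε hε
  have hq : 2 * ‖z‖ / R < 1 := (div_lt_one hR).2 hz
  have hlim : Tendsto (fun m : ℕ => (2 * ‖z‖ / R) ^ m * M) atTop (𝓝 (0 * M)) :=
    (tendsto_pow_atTop_nhds_zero_of_lt_one (by positivity) hq).mul_const M
  rw [zero_mul] at hlim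
  obtain ⟨m, hm⟩ := (hlim.eventually (gt_mem_nhds (half_pos hε))).exists
  filter_upwards [eventually_norm_le_pow_of_tendsto_zero_on_real m hR hM hd hb hx hzb
    (show 0 < ε / 3 by positivity)] with k hk
  rw [dist_zero_right]
  linarith

/-! ### From moment generating functions to Fourier integrals -/

open MeasureTheory ProbabilityTheory in
/-- A special case of Curtiss's theorem: pointwise convergence of the moment generating functions
to that of a centred Gaussian forces pointwise convergence of the characteristic functions. -/
theorem tendsto_charFun_of_tendsto_mgf {Q : ℕ → Measure ℝ} {a : ℝ}
    (hint : ∀ v : ℝ, ∀ᶠ k in atTop, v ∈ integrableExpSet id (Q k))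
    (hmgf : ∀ v : ℝ, Tendsto (fun k => mgf id (Q k) v) atTop (𝓝 (Real.exp (a * v ^ 2)))) (w : ℝ) :
    Tendsto (fun k => charFun (Q k) w) atTop (𝓝 (Complex.exp (-(a * w ^ 2 : ℝ)))) := by
  set R : ℝ := 2 * |w| + 1 with hR
  have hRpos : 0 < R := by positivity
  have hre : ∀ z ∈ Metric.ball (0 : ℂ) R, |z.re| < R := fun z hz =>
    (Complex.abs_re_le_norm z).trans_lt (by simpa using hz)
  -- The limit `exp (a z²)` is bounded on the disc by its value at `R` with `a` replaced by `|a|`.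
  set M : ℝ := (Real.exp (a * R ^ 2) + 1) + (Real.exp (a * (-R) ^ 2) + 1) +
    Real.exp (|a| * R ^ 2) with hM
  have hMpos : 0 < M := by positivity
  have hlim := tendsto_zero_of_tendsto_zero_on_real (R := R) (M := M)
    (f := fun k z => complexMGF id (Q k) z - Complex.exp (a * z ^ 2)) hMpos ?_ ?_ ?_
    (z := (w : ℂ) * Complex.I) (by simp [hR])
  · have h1 := hlim.add_const (Complex.exp (a * ((w : ℂ) * Complex.I) ^ 2))
    simp only [sub_add_cancel, zero_add] at h1
    have h2 : (a : ℂ) * ((w : ℂ) * Complex.I) ^ 2 = (-(a * w ^ 2 : ℝ) : ℂ) := by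
      rw [mul_pow, Complex.I_sq]; push_cast; ring
    rw [h2] at h1
    exact h1.congr fun k => complexMGF_id_mul_I w
  · filter_upwards [hint R, hint (-R)] with k h1 h2
    have hsub : {z : ℂ | z.re ∈ Set.Ioo (-R) R} ⊆ {z | z.re ∈ interior (integrableExpSet id (Q k))} :=
      fun z hz => (interior_maximal (Set.Ioo_subset_Icc_self.trans
        ((convex_integrableExpSet.ordConnected).out h2 h1)) isOpen_Ioo) hz
    refine ((differentiableOn_complexMGF).mono fun z hz => hsub ?_).sub ?_
    · exact abs_lt.1 (hre z hz)
    · exact Differentiable.differentiableOn (by fun_prop)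
  · have e1 := (hmgf R).eventually (gt_mem_nhds (lt_add_one _))
    have e2 := (hmgf (-R)).eventually (gt_mem_nhds (lt_add_one _))
    filter_upwards [hint R, hint (-R), e1, e2] with k h1 h2 h3 h4 z hz
    have hz' := abs_lt.1 (hre z hz)
    have hz2 : ‖z‖ < R := by simpa using hz
    refine (norm_sub_le _ _).trans (add_le_add ?_ ?_)
    · refine norm_complexMGF_le_mgf.trans ?_
      have : mgf id (Q k) z.re ≤ mgf id (Q k) R + mgf id (Q k) (-R) := by
        unfold mgf
        rw [← integral_add h1 h2]
        refine integral_mono_of_nonneg (ae_of_all _ fun x => (Real.exp_pos _).le) (h1.add h2)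
          (ae_of_all _ fun x => ?_)
        simp only [id]
        rcases le_total 0 x with hx | hx
        · have : Real.exp (z.re * x) ≤ Real.exp (R * x) := by
            gcongr; exact hz'.2.le
          linarith [Real.exp_pos (-R * x)]
        · have : Real.exp (z.re * x) ≤ Real.exp (-R * x) :=
            Real.exp_le_exp.2 (mul_le_mul_of_nonpos_right hz'.1.le hx)
          linarith [Real.exp_pos (R * x)]
      linarith
    · refine (Complex.norm_exp_le_exp_norm _).trans (Real.exp_le_exp.2 ?_)
      rw [norm_mul, norm_pow, Complex.norm_real, Real.norm_eq_abs]
      gcongr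
  · intro x _
    have h1 : Tendsto (fun k => ((mgf id (Q k) x : ℝ) : ℂ)) atTop
        (𝓝 ((Real.exp (a * x ^ 2) : ℝ) : ℂ)) :=
      (Complex.continuous_ofReal.tendsto _).comp (hmgf x)
    have h2 := h1.sub_const (Complex.exp (a * (x : ℂ) ^ 2))
    have h3 : ((Real.exp (a * x ^ 2) : ℝ) : ℂ) = Complex.exp (a * (x : ℂ) ^ 2) := by push_cast; rfl
    rw [h3, sub_self] at h2
    refine h2.congr fun k => ?_
    rw [complexMGF_ofReal]

open MeasureTheory in
/-- If the characteristic functions, rescaled by `ε k → 0`, converge to a Gaussian and are dominated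
by a Gaussian on every bounded window, then integration of compactly supported functions against
them isolates the value at the origin. -/
theorem tendsto_integral_mul_charFun {P : ℕ → Measure ℝ} {ε : ℕ → ℝ} {a : ℝ}
    (hε : ∀ k, 0 < ε k) (hε0 : Tendsto ε atTop (𝓝 0))
    (hchar : ∀ w : ℝ, Tendsto (fun k => charFun (P k) (ε k * w)) atTop
      (𝓝 (Complex.exp (-(a * w ^ 2 : ℝ)))))
    (hdom : ∀ R : ℝ, 0 < R → ∃ C κ : ℝ, 0 < κ ∧ ∀ᶠ k in atTop, ∀ u : ℝ, |u| ≤ R →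
      ‖charFun (P k) u‖ ≤ C * Real.exp (-κ * (u / ε k) ^ 2))
    [∀ k, IsProbabilityMeasure (P k)]
    {h : ℝ → ℂ} (hc : Continuous h) (hs : HasCompactSupport h) :
    Tendsto (fun k => ((ε k)⁻¹ : ℂ) * ∫ u, h u * charFun (P k) u) atTop
      (𝓝 (h 0 * (Real.sqrt (Real.pi / a) : ℝ))) := by
  obtain ⟨H, hH⟩ := hc.bounded_above_of_compact_support hs
  obtain ⟨R, hRpos, hR⟩ : ∃ R : ℝ, 0 < R ∧ ∀ u, h u ≠ 0 → |u| ≤ R := by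
    obtain ⟨R, hR0, hR⟩ := hs.isCompact.isBounded.exists_pos_norm_le
    exact ⟨R, hR0, fun u hu => hR u (subset_tsupport _ hu)⟩
  obtain ⟨C, κ, hκ, hdom⟩ := hdom R hRpos
  have hH0 : 0 ≤ H := (norm_nonneg _).trans (hH 0)
  have hlim : Tendsto (fun k => ∫ w, h (ε k * w) * charFun (P k) (ε k * w)) atTop
      (𝓝 (∫ w : ℝ, h 0 * Complex.exp (-(a * w ^ 2 : ℝ)))) := by
    refine tendsto_integral_filter_of_dominated_convergence
      (fun w => H * (|C| * Real.exp (-κ * w ^ 2))) ?_ ?_ ?_ ?_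
    · refine Eventually.of_forall fun k => ?_
      have : Measurable fun w => charFun (P k) (ε k * w) := by fun_prop
      exact ((hc.comp (continuous_const.mul continuous_id)).measurable.mul this).aestronglyMeasurable
    · filter_upwards [hdom] with k hk
      refine ae_of_all _ fun w => ?_
      by_cases h0 : h (ε k * w) = 0
      · rw [h0]; simp; positivity
      · rw [norm_mul]
        refine mul_le_mul (hH _) ?_ (norm_nonneg _) hH0
        refine (hk _ (hR _ h0)).trans ?_
        rw [mul_div_cancel_left₀ _ (hε k).ne']
        gcongr
        exact le_abs_self C
    · exact ((integrable_exp_neg_mul_sq hκ).const_mul _).const_mul _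
    · refine ae_of_all _ fun w => ?_
      refine Tendsto.mul ?_ (hchar w)
      have : Tendsto (fun k => ε k * w) atTop (𝓝 0) := by simpa using hε0.mul_const w
      exact (hc.tendsto 0).comp this
  have hval : ∫ w : ℝ, h 0 * Complex.exp (-(a * w ^ 2 : ℝ))
      = h 0 * (Real.sqrt (Real.pi / a) : ℝ) := by
    rw [integral_const_mul, ← integral_gaussian a, ← integral_complex_ofReal]
    congr 2
    ext w
    push_cast; ring_nf
  rw [hval] at hlim
  refine hlim.congr fun k => ?_
  have := Measure.integral_comp_mul_left (fun u => h u * charFun (P k) u) (ε k)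
  rw [this, abs_of_pos (inv_pos.2 (hε k)), Complex.real_smul, Complex.ofReal_inv]

open MeasureTheory in
/-- Fubini's theorem for a function given as a Fourier integral, integrated against a
character. -/
lemma integral_exp_mul_fourier {P : Measure ℝ} [IsProbabilityMeasure P] {g : ℝ → ℂ}
    (hg : Integrable g) {G : ℝ → ℂ}
    (hG : ∀ s : ℝ, ∫ u : ℝ, g u * Complex.exp (u * s * Complex.I) = G s) (y : ℝ) :
    ∫ s : ℝ, Complex.exp (y * s * Complex.I) * G s ∂P = ∫ u : ℝ, g (u - y) * charFun P u := by
  have h1 : ∫ u : ℝ, g (u - y) * charFun P u = ∫ u : ℝ, g u * charFun P (u + y) := by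
    rw [← integral_add_right_eq_self (μ := volume) (fun u => g (u - y) * charFun P u) y]
    simp
  rw [h1]
  simp_rw [charFun_apply_real, ← hG, ← integral_const_mul]
  rw [integral_integral_swap]
  · congr 1; ext u; congr 1; ext s
    rw [mul_left_comm, ← Complex.exp_add]
    congr 2; push_cast; ring
  · have h2 : Integrable (fun p : ℝ × ℝ => (1 : ℂ) * g p.2) (P.prod volume) :=
      Integrable.mul_prod (f := fun _ : ℝ => (1 : ℂ)) (integrable_const 1) hg
    refine h2.mono ?_ (ae_of_all _ fun p => ?_)
    · have h3 : AEStronglyMeasurable (fun p : ℝ × ℝ => g p.2) (P.prod volume) := by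
        simpa using h2.aestronglyMeasurable
      refine AEStronglyMeasurable.mul ?_ (h3.mul ?_)
      · exact (by fun_prop : Continuous fun p : ℝ × ℝ => Complex.exp (y * p.1 * Complex.I)).aestronglyMeasurable
      · exact (by fun_prop : Continuous fun p : ℝ × ℝ => Complex.exp (p.2 * p.1 * Complex.I)).aestronglyMeasurable
    · have e : ∀ x y : ℝ, ‖Complex.exp (x * y * Complex.I)‖ = 1 := fun x y => by
        rw [← Complex.ofReal_mul, Complex.norm_exp_ofReal_mul_I]
      simp [e, Function.uncurry]

/-! ### A positive kernel with compactly supported Fourier transform -/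

/-- The triangle function on `[-1, 1]`. -/
noncomputable def triangle (u : ℝ) : ℝ := max (1 - |u|) 0

/-- The Fejér kernel `(sin (s/2) / (s/2))²`, the Fourier transform of the triangle function. -/
noncomputable def fejer (s : ℝ) : ℝ := Real.sinc (s / 2) ^ 2

/-- The sum of the Fejér kernel and its translate by `π`. The zeros of one summand are never zeros
of the other, so that this kernel is positive everywhere. -/
noncomputable def fejerPair (s : ℝ) : ℝ := fejer s + fejer (s + Real.pi)

/-- The compactly supported function whose integral against `e^{ius}` is `fejerPair s`. -/
noncomputable def trianglePair (u : ℝ) : ℂ :=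
  (triangle u : ℂ) * (1 + Complex.exp (u * Real.pi * Complex.I))

lemma continuous_triangle : Continuous triangle := by unfold triangle; fun_prop

lemma triangle_eq_zero {u : ℝ} (hu : 1 ≤ |u|) : triangle u = 0 := by
  unfold triangle; exact max_eq_right (by linarith)

lemma hasCompactSupport_triangle : HasCompactSupport triangle := by
  refine HasCompactSupport.intro (isCompact_Icc (a := -1) (b := 1)) fun u hu => triangle_eq_zero ?_
  by_contra! h
  exact hu ⟨(abs_lt.1 h).1.le, (abs_lt.1 h).2.le⟩

lemma continuous_trianglePair : Continuous trianglePair := by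
  have := continuous_triangle
  unfold trianglePair; fun_prop

lemma hasCompactSupport_trianglePair : HasCompactSupport trianglePair := by
  refine HasCompactSupport.intro (isCompact_Icc (a := -1) (b := 1)) fun u hu => ?_
  rw [trianglePair, triangle_eq_zero]
  · simp
  · by_contra! h
    exact hu ⟨(abs_lt.1 h).1.le, (abs_lt.1 h).2.le⟩

lemma trianglePair_zero : trianglePair 0 = 2 := by
  simp [trianglePair, triangle]; norm_num

lemma continuous_fejer : Continuous fejer := by
  have := Real.continuous_sinc
  unfold fejer; fun_prop

lemma continuous_fejerPair : Continuous fejerPair := by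
  have := continuous_fejer
  unfold fejerPair; fun_prop

lemma fejer_nonneg (s : ℝ) : 0 ≤ fejer s := sq_nonneg _

lemma sq_mul_fejer (s : ℝ) : s ^ 2 * fejer s = 4 * Real.sin (s / 2) ^ 2 := by
  by_cases hs : s = 0
  · simp [hs]
  · rw [fejer, Real.sinc_of_ne_zero (by simpa using hs)]
    field_simp
    ring

lemma fejer_le_one (s : ℝ) : fejer s ≤ 1 := by
  rw [fejer, sq_le_one_iff_abs_le_one]
  exact Real.abs_sinc_le_one _

lemma fejerPair_le_two (s : ℝ) : fejerPair s ≤ 2 := by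
  unfold fejerPair; linarith [fejer_le_one s, fejer_le_one (s + Real.pi)]

lemma fejerPair_lower_bound (s : ℝ) : 4 ≤ (|s| + Real.pi) ^ 2 * fejerPair s := by
  have h1 := sq_mul_fejer s
  have h2 := sq_mul_fejer (s + Real.pi)
  rw [add_div, Real.sin_add_pi_div_two] at h2
  have h3 : s ^ 2 ≤ (|s| + Real.pi) ^ 2 := by
    rw [← sq_abs s]
    gcongr
    linarith [Real.pi_pos]
  have h4 : (s + Real.pi) ^ 2 ≤ (|s| + Real.pi) ^ 2 := by
    refine sq_le_sq' ?_ ?_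
    · linarith [neg_abs_le s, Real.pi_pos]
    · linarith [le_abs_self s]
  have h5 := mul_le_mul_of_nonneg_right h3 (fejer_nonneg s)
  have h6 := mul_le_mul_of_nonneg_right h4 (fejer_nonneg (s + Real.pi))
  unfold fejerPair
  nlinarith [Real.sin_sq_add_cos_sq (s / 2)]

lemma fejerPair_pos (s : ℝ) : 0 < fejerPair s := by
  have := fejerPair_lower_bound s
  by_contra! h
  nlinarith [sq_nonneg (|s| + Real.pi)]

open MeasureTheory in
lemma integrable_fejer : Integrable fejer := by
  refine (integrable_inv_one_add_sq.const_mul 5).mono' continuous_fejer.aestronglyMeasurable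
    (ae_of_all _ fun s => ?_)
  rw [Real.norm_eq_abs, abs_of_nonneg (fejer_nonneg s), ← div_eq_mul_inv,
    le_div_iff₀ (by positivity)]
  nlinarith [sq_mul_fejer s, fejer_le_one s, Real.sin_sq_le_one (s / 2)]

open MeasureTheory in
lemma integrable_fejerPair : Integrable fejerPair :=
  integrable_fejer.add (integrable_fejer.comp_add_right Real.pi)

open MeasureTheory in
lemma integral_triangle_mul_exp (s : ℝ) :
    ∫ u : ℝ, (triangle u : ℂ) * Complex.exp (u * s * Complex.I) = fejer s := by
  have hc : Continuous fun u : ℝ => (triangle u : ℂ) * Complex.exp (u * s * Complex.I) := by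
    have := continuous_triangle
    fun_prop
  have h1 : ∫ u : ℝ, (triangle u : ℂ) * Complex.exp (u * s * Complex.I)
      = ∫ u in (-1 : ℝ)..1, (triangle u : ℂ) * Complex.exp (u * s * Complex.I) := by
    rw [intervalIntegral.integral_of_le (by norm_num), ← integral_Icc_eq_integral_Ioc,
      setIntegral_eq_integral_of_forall_compl_eq_zero]
    intro u hu
    rw [triangle_eq_zero]
    · simp
    · by_contra! h
      exact hu ⟨(abs_lt.1 h).1.le, (abs_lt.1 h).2.le⟩
  rw [h1, ← intervalIntegral.integral_add_adjacent_intervals (b := 0)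
    (hc.intervalIntegrable _ _) (hc.intervalIntegrable _ _)]
  have h2 : ∫ u in (-1 : ℝ)..0, (triangle u : ℂ) * Complex.exp (u * s * Complex.I)
      = ∫ u in (-1 : ℝ)..0, (1 + (u : ℂ)) * Complex.exp (u * s * Complex.I) := by
    refine intervalIntegral.integral_congr fun u hu => ?_
    rw [Set.uIcc_of_le (by norm_num)] at hu
    have : triangle u = 1 + u := by
      rw [triangle, abs_of_nonpos hu.2, max_eq_left] <;> linarith [hu.1]
    simp [this]
  have h3 : ∫ u in (0 : ℝ)..1, (triangle u : ℂ) * Complex.exp (u * s * Complex.I)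
      = ∫ u in (0 : ℝ)..1, (1 - (u : ℂ)) * Complex.exp (u * s * Complex.I) := by
    refine intervalIntegral.integral_congr fun u hu => ?_
    rw [Set.uIcc_of_le (by norm_num)] at hu
    have : triangle u = 1 - u := by
      rw [triangle, abs_of_nonneg hu.1, max_eq_left]; linarith [hu.2]
    simp [this]
  rw [h2, h3]
  by_cases hs : s = 0
  · subst hs
    have e1 : ∫ u in (-1 : ℝ)..0, (1 + (u : ℂ)) = ((∫ u in (-1 : ℝ)..0, (1 + u) : ℝ) : ℂ) := by
      rw [← intervalIntegral.integral_ofReal]; simp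
    have e2 : ∫ u in (0 : ℝ)..1, (1 - (u : ℂ)) = ((∫ u in (0 : ℝ)..1, (1 - u) : ℝ) : ℂ) := by
      rw [← intervalIntegral.integral_ofReal]; simp
    simp only [Complex.ofReal_zero, mul_zero, zero_mul, Complex.exp_zero, mul_one, e1, e2]
    rw [intervalIntegral.integral_add (by simp) (by simp),
      intervalIntegral.integral_sub (by simp) (by simp)]
    norm_num [fejer]
  set c : ℂ := s * Complex.I with hcdef
  have hc0 : c ≠ 0 := by simp [hcdef, hs]
  have hexp : ∀ u : ℝ, HasDerivAt (fun u : ℝ => Complex.exp (u * s * Complex.I))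
      (Complex.exp (u * s * Complex.I) * c) u := fun u => by
    have : HasDerivAt (fun u : ℝ => (u : ℂ) * s * Complex.I) c u := by
      simpa [hcdef, mul_assoc] using (Complex.ofRealCLM.hasDerivAt (x := u)).mul_const c
    exact this.cexp
  have hid : ∀ u : ℝ, HasDerivAt (fun u : ℝ => (u : ℂ)) 1 u := fun u =>
    Complex.ofRealCLM.hasDerivAt (x := u)
  have i1 := intervalIntegral.integral_eq_sub_of_hasDerivAt (a := -1) (b := 0)
    (f := fun u : ℝ => ((1 + (u : ℂ)) / c - 1 / c ^ 2) * Complex.exp (u * s * Complex.I))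
    (f' := fun u : ℝ => (1 + (u : ℂ)) * Complex.exp (u * s * Complex.I)) (fun u _ => by
      have := ((((hid u).const_add 1).div_const c).sub_const (1 / c ^ 2)).mul (hexp u)
      refine this.congr_deriv ?_
      field_simp
      ring) (Continuous.intervalIntegrable (by fun_prop) _ _)
  have i2 := intervalIntegral.integral_eq_sub_of_hasDerivAt (a := 0) (b := 1)
    (f := fun u : ℝ => ((1 - (u : ℂ)) / c + 1 / c ^ 2) * Complex.exp (u * s * Complex.I))
    (f' := fun u : ℝ => (1 - (u : ℂ)) * Complex.exp (u * s * Complex.I)) (fun u _ => by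
      have := ((((hid u).const_sub 1).div_const c).add_const (1 / c ^ 2)).mul (hexp u)
      refine this.congr_deriv ?_
      field_simp
      ring) (Continuous.intervalIntegrable (by fun_prop) _ _)
  rw [i1, i2]
  have hc2 : c ^ 2 = -(s : ℂ) ^ 2 := by rw [hcdef, mul_pow, Complex.I_sq]; ring
  have hcos : Complex.exp (s * Complex.I) + Complex.exp (-s * Complex.I) = 2 * Complex.cos s :=
    (Complex.two_cos s).symm
  have hf : (s : ℂ) ^ 2 * fejer s = 2 - 2 * Complex.cos s := by
    have h4 : s ^ 2 * fejer s = 2 - 2 * Real.cos s := by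
      have h5 := Real.cos_two_mul (s / 2)
      rw [mul_div_cancel₀ s two_ne_zero] at h5
      rw [sq_mul_fejer, h5]
      linarith [Real.sin_sq_add_cos_sq (s / 2)]
    exact_mod_cast congrArg (fun x : ℝ => (x : ℂ)) h4
  have hs2 : (s : ℂ) ^ 2 ≠ 0 := by simp [hs]
  refine mul_left_cancel₀ hs2 ?_
  rw [hf, ← neg_neg ((s : ℂ) ^ 2), ← hc2]
  clear_value c
  simp only [Complex.ofReal_zero, Complex.ofReal_one, Complex.ofReal_neg, zero_mul,
    Complex.exp_zero, one_mul, neg_mul] at hcos ⊢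
  field_simp
  linear_combination -hcos

open MeasureTheory in
lemma integrable_trianglePair : Integrable trianglePair :=
  continuous_trianglePair.integrable_of_hasCompactSupport hasCompactSupport_trianglePair

open MeasureTheory in
lemma integral_trianglePair_mul_exp (s : ℝ) :
    ∫ u : ℝ, trianglePair u * Complex.exp (u * s * Complex.I) = fejerPair s := by
  have hi : ∀ s : ℝ, Integrable fun u : ℝ => (triangle u : ℂ) * Complex.exp (u * s * Complex.I) := by
    intro s
    have := continuous_triangle
    refine Continuous.integrable_of_hasCompactSupport (by fun_prop) ?_
    refine HasCompactSupport.mul_right ?_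
    exact hasCompactSupport_triangle.comp_left (g := fun x : ℝ => (x : ℂ)) (by simp)
  rw [fejerPair, Complex.ofReal_add, ← integral_triangle_mul_exp, ← integral_triangle_mul_exp,
    ← integral_add (hi s) (hi _)]
  congr 1; ext u
  rw [trianglePair, mul_assoc, add_mul, one_mul, ← Complex.exp_add, ← mul_add]
  congr 3; push_cast; ring_nf

open MeasureTheory FourierTransform in
lemma integral_exp_mul_fejer (y : ℝ) :
    ∫ s : ℝ, Complex.exp (y * s * Complex.I) * fejer s = 2 * Real.pi * triangle y := by
  set f : ℝ → ℂ := fun u => (triangle u : ℂ) with hf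
  have hfc : Continuous f := Complex.continuous_ofReal.comp continuous_triangle
  have hfi : Integrable f := hfc.integrable_of_hasCompactSupport
    (hasCompactSupport_triangle.comp_left (g := fun x : ℝ => (x : ℂ)) (by simp))
  have hF : 𝓕 f = fun ξ => (fejer (-(2 * Real.pi * ξ)) : ℂ) := by
    ext ξ
    rw [Real.fourier_real_eq_integral_exp_smul, ← integral_triangle_mul_exp]
    congr 1; ext u
    rw [smul_eq_mul, mul_comm]
    congr 2; push_cast; ring
  have hFi : Integrable (𝓕 f) := by
    rw [hF]
    have : Integrable fun ξ => fejer (-(2 * Real.pi * ξ)) := by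
      have := integrable_fejer.comp_mul_left' (R := -(2 * Real.pi)) (by simp [Real.pi_ne_zero])
      simpa only [neg_mul] using this
    exact this.ofReal
  have hinv := congrFun (hfc.fourierInv_fourier_eq hfi hFi) y
  rw [Real.fourierInv_eq', hF] at hinv
  have h1 := Measure.integral_comp_mul_left
    (fun s : ℝ => Complex.exp (y * s * Complex.I) * fejer s) (2 * Real.pi)
  have h2 : ∀ s, fejer (-s) = fejer s := fun s => by simp [fejer, neg_div]
  have h3 : ∫ ξ : ℝ, Complex.exp (y * ((2 * Real.pi * ξ : ℝ) : ℂ) * Complex.I) *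
      fejer (2 * Real.pi * ξ) = f y := by
    rw [← hinv]
    congr 1; ext ξ
    simp only [h2, smul_eq_mul]
    congr 2
    simp only [RCLike.inner_apply, conj_trivial]
    push_cast; ring
  rw [h3, abs_of_pos (by positivity), Complex.real_smul] at h1
  have h4 : (Real.pi : ℂ) ≠ 0 := by exact_mod_cast Real.pi_ne_zero
  rw [hf] at h1
  simp only at h1
  rw [h1]
  generalize ∫ s : ℝ, Complex.exp (y * s * Complex.I) * fejer s = J
  push_cast
  field_simp

open MeasureTheory in
lemma integral_exp_mul_fejerPair (y : ℝ) :
    ∫ s : ℝ, Complex.exp (y * s * Complex.I) * fejerPair s = 2 * Real.pi * trianglePair (-y) := by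
  have hi : Integrable fun s : ℝ => Complex.exp (y * s * Complex.I) * fejer s := by
    refine (Integrable.ofReal (𝕜 := ℂ) integrable_fejer).bdd_mul (c := 1) (by fun_prop)
      (ae_of_all _ fun s => ?_)
    rw [← Complex.ofReal_mul, Complex.norm_exp_ofReal_mul_I]
  have hshift := hi.comp_add_right Real.pi
  have e : ∀ s : ℝ, Complex.exp (y * s * Complex.I) * fejerPair s
      = Complex.exp (y * s * Complex.I) * fejer s + Complex.exp (-(y * Real.pi * Complex.I)) *
        (Complex.exp (y * (s + Real.pi : ℝ) * Complex.I) * fejer (s + Real.pi)) := fun s => by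
    rw [← mul_assoc, ← Complex.exp_add, fejerPair, Complex.ofReal_add, mul_add]
    congr 3; push_cast; ring
  simp_rw [e]
  rw [integral_add hi (hshift.const_mul _), integral_const_mul,
    integral_add_right_eq_self (μ := volume)
      (fun s : ℝ => Complex.exp (y * s * Complex.I) * fejer s) Real.pi,
    integral_exp_mul_fejer, trianglePair]
  have : triangle (-y) = triangle y := by simp [triangle]
  rw [this]; push_cast; ring_nf

/-! ### A local limit theorem -/

open MeasureTheory in
lemma charFun_tilted_log {μ : Measure ℝ} {G : ℝ → ℝ} (hG : ∀ s, 0 < G s) (y : ℝ) :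
    charFun (μ.tilted fun s => Real.log (G s)) y
      = ((∫ s, G s ∂μ : ℝ) : ℂ)⁻¹ * ∫ s, Complex.exp (y * s * Complex.I) * G s ∂μ := by
  rw [charFun_apply_real, integral_tilted, ← integral_const_mul]
  simp only [Real.exp_log (hG _)]
  congr 1; ext s
  rw [Complex.real_smul]; push_cast; ring

open MeasureTheory in
lemma integral_tilted_log {μ : Measure ℝ} {G : ℝ → ℝ} (hG : ∀ s, 0 < G s) (f : ℝ → ℝ) :
    ∫ s, f s ∂(μ.tilted fun s => Real.log (G s)) = (∫ s, G s ∂μ)⁻¹ * ∫ s, f s * G s ∂μ := by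
  rw [integral_tilted, ← integral_const_mul]
  simp only [Real.exp_log (hG _)]
  congr 1; ext s
  rw [smul_eq_mul]; ring

open MeasureTheory in
lemma integral_fejerPair : ∫ s, fejerPair s = 4 * Real.pi := by
  have h := integral_exp_mul_fejerPair 0
  rw [neg_zero, trianglePair_zero] at h
  simp only [Complex.ofReal_zero, zero_mul, Complex.exp_zero, one_mul] at h
  rw [integral_complex_ofReal] at h
  have h2 : ((∫ s, fejerPair s : ℝ) : ℂ) = ((4 * Real.pi : ℝ) : ℂ) := by
    rw [h]; push_cast; ring
  exact_mod_cast h2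

open MeasureTheory in
lemma integrable_fejerPair_of_isFiniteMeasure (P : Measure ℝ) [IsFiniteMeasure P] :
    Integrable fejerPair P :=
  Integrable.of_bound continuous_fejerPair.aestronglyMeasurable 2 (ae_of_all _ fun s => by
    rw [Real.norm_eq_abs, abs_of_pos (fejerPair_pos s)]; exact fejerPair_le_two s)

open MeasureTheory in
/-- Under the hypotheses of the local limit theorem, the measures `(ε k)⁻¹ • P k` converge to a
multiple of Lebesgue measure when tested against bounded continuous multiples of `fejerPair`. After
multiplication by this kernel the measures are finite and the hypotheses determine the limits of
their characteristic functions, so Lévy's convergence theorem applies. -/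
theorem tendsto_integral_mul_fejerPair {P : ℕ → Measure ℝ} [∀ k, IsProbabilityMeasure (P k)]
    {ε : ℕ → ℝ} {a : ℝ} (ha : 0 < a)
    (hε : ∀ k, 0 < ε k) (hε0 : Tendsto ε atTop (𝓝 0))
    (hchar : ∀ w : ℝ, Tendsto (fun k => charFun (P k) (ε k * w)) atTop
      (𝓝 (Complex.exp (-(a * w ^ 2 : ℝ)))))
    (hdom : ∀ R : ℝ, 0 < R → ∃ C κ : ℝ, 0 < κ ∧ ∀ᶠ k in atTop, ∀ u : ℝ, |u| ≤ R →
      ‖charFun (P k) u‖ ≤ C * Real.exp (-κ * (u / ε k) ^ 2))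
    (f : BoundedContinuousFunction ℝ ℝ) :
    Tendsto (fun k => (ε k)⁻¹ * ∫ s, f s * fejerPair s ∂(P k)) atTop
      (𝓝 (Real.sqrt (Real.pi / a) / (2 * Real.pi) * ∫ s, f s * fejerPair s)) := by
  set A : ℕ → ℝ := fun k => ∫ s, fejerPair s ∂(P k) with hA
  have hApos : ∀ k, 0 < A k := fun k => by
    rw [hA, integral_pos_iff_support_of_nonneg (fun s => (fejerPair_pos s).le)
      (integrable_fejerPair_of_isFiniteMeasure _)]
    have : Function.support fejerPair = Set.univ := by
      ext s; simp [(fejerPair_pos s).ne']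
    simp [this]
  have hS : 0 < Real.sqrt (Real.pi / a) := Real.sqrt_pos.2 (by positivity)
  have hy : ∀ y : ℝ, Tendsto (fun k => ((ε k)⁻¹ : ℂ) *
      ∫ s : ℝ, Complex.exp (y * s * Complex.I) * fejerPair s ∂(P k)) atTop
      (𝓝 (trianglePair (-y) * (Real.sqrt (Real.pi / a) : ℝ))) := by
    intro y
    have h := tendsto_integral_mul_charFun hε hε0 hchar hdom
      (h := fun u => trianglePair (u - y))
      (continuous_trianglePair.comp (continuous_sub_right y))
      (hasCompactSupport_trianglePair.comp_homeomorph (Homeomorph.subRight y))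
    rw [zero_sub] at h
    refine h.congr fun k => ?_
    rw [integral_exp_mul_fourier integrable_trianglePair (G := fun s => (fejerPair s : ℂ))
      integral_trianglePair_mul_exp]
  have hAlimC : Tendsto (fun k => ((ε k)⁻¹ : ℂ) * (A k : ℂ)) atTop
      (𝓝 (2 * (Real.sqrt (Real.pi / a) : ℝ))) := by
    have h := hy 0
    rw [neg_zero, trianglePair_zero] at h
    refine h.congr fun k => ?_
    simp only [Complex.ofReal_zero, zero_mul, Complex.exp_zero, one_mul, hA]
    rw [integral_complex_ofReal]
  have hAlim : Tendsto (fun k => (ε k)⁻¹ * A k) atTop (𝓝 (2 * Real.sqrt (Real.pi / a))) := by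
    have := (Complex.continuous_re.tendsto _).comp hAlimC
    have e : ((2 : ℂ) * (Real.sqrt (Real.pi / a) : ℝ)).re = 2 * Real.sqrt (Real.pi / a) := by
      simp
    rw [e] at this
    refine this.congr fun k => ?_
    simp only [Function.comp, ← Complex.ofReal_inv, ← Complex.ofReal_mul, Complex.ofReal_re]
  have hintP : ∀ k, Integrable (fun s => Real.exp (Real.log (fejerPair s))) (P k) := fun k => by
    simpa only [Real.exp_log (fejerPair_pos _)] using integrable_fejerPair_of_isFiniteMeasure (P k)
  have hintV : Integrable (fun s => Real.exp (Real.log (fejerPair s))) := by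
    simpa only [Real.exp_log (fejerPair_pos _)] using integrable_fejerPair
  let ν : ℕ → ProbabilityMeasure ℝ := fun k =>
    ⟨(P k).tilted fun s => Real.log (fejerPair s), isProbabilityMeasure_tilted (hintP k)⟩
  let ν₀ : ProbabilityMeasure ℝ :=
    ⟨(volume : Measure ℝ).tilted fun s => Real.log (fejerPair s), isProbabilityMeasure_tilted hintV⟩
  have hν : Tendsto ν atTop (𝓝 ν₀) := by
    refine ProbabilityMeasure.tendsto_of_tendsto_charFun fun y => ?_
    change Tendsto (fun k => charFun ((P k).tilted fun s => Real.log (fejerPair s)) y) atTop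
      (𝓝 (charFun ((volume : Measure ℝ).tilted fun s => Real.log (fejerPair s)) y))
    rw [charFun_tilted_log fejerPair_pos, integral_fejerPair, integral_exp_mul_fejerPair]
    simp_rw [charFun_tilted_log fejerPair_pos]
    have hSC : ((Real.sqrt (Real.pi / a) : ℝ) : ℂ) ≠ 0 := by exact_mod_cast hS.ne'
    have h := (hy y).div hAlimC (mul_ne_zero two_ne_zero hSC)
    have e : trianglePair (-y) * (Real.sqrt (Real.pi / a) : ℝ) /
        (2 * (Real.sqrt (Real.pi / a) : ℝ))
        = ((4 * Real.pi : ℝ) : ℂ)⁻¹ * (2 * Real.pi * trianglePair (-y)) := by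
      have : (Real.pi : ℂ) ≠ 0 := by exact_mod_cast Real.pi_ne_zero
      push_cast
      field_simp
      norm_num
    rw [e] at h
    refine h.congr fun k => ?_
    have h1 : ((ε k : ℝ) : ℂ) ≠ 0 := by exact_mod_cast (hε k).ne'
    have h2 : ((A k : ℝ) : ℂ) ≠ 0 := by exact_mod_cast (hApos k).ne'
    simp only [Pi.div_apply]
    change _ = ((A k : ℝ) : ℂ)⁻¹ * _
    generalize ∫ s : ℝ, Complex.exp (y * s * Complex.I) * fejerPair s ∂(P k) = J
    field_simp
  have hf := (ProbabilityMeasure.tendsto_iff_forall_integral_tendsto.1 hν) f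
  change Tendsto (fun k => ∫ s, f s ∂((P k).tilted fun s => Real.log (fejerPair s))) atTop
      (𝓝 (∫ s, f s ∂((volume : Measure ℝ).tilted fun s => Real.log (fejerPair s)))) at hf
  rw [integral_tilted_log fejerPair_pos, integral_fejerPair] at hf
  simp_rw [integral_tilted_log fejerPair_pos] at hf
  have h := hAlim.mul hf
  have e : 2 * Real.sqrt (Real.pi / a) * ((4 * Real.pi)⁻¹ * ∫ s, f s * fejerPair s)
      = Real.sqrt (Real.pi / a) / (2 * Real.pi) * ∫ s, f s * fejerPair s := by
    field_simp; norm_num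
  rw [e] at h
  refine h.congr fun k => ?_
  have h2 := (hApos k).ne'
  change (ε k)⁻¹ * A k * ((A k)⁻¹ * _) = _
  field_simp

/-- The function `exp s`, cut off continuously to zero between `δ - η` and `δ`. -/
noncomputable def expCutoff (δ η s : ℝ) : ℝ := Real.exp s * max 0 (min 1 ((δ - s) / η))

lemma continuous_expCutoff (δ η : ℝ) : Continuous (expCutoff δ η) := by
  unfold expCutoff; fun_prop

lemma expCutoff_nonneg (δ η s : ℝ) : 0 ≤ expCutoff δ η s :=
  mul_nonneg (Real.exp_pos _).le (le_max_left _ _)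

lemma expCutoff_le {δ η : ℝ} (hη : 0 < η) (s : ℝ) :
    expCutoff δ η s ≤ (Set.Iic δ).indicator Real.exp s := by
  by_cases h : s ≤ δ
  · rw [Set.indicator_of_mem (Set.mem_Iic.2 h)]
    exact mul_le_of_le_one_right (Real.exp_pos _).le (max_le zero_le_one (min_le_left _ _))
  · rw [Set.indicator_of_notMem (by simpa using h), expCutoff, max_eq_left, mul_zero]
    exact (min_le_right _ _).trans (div_nonpos_of_nonpos_of_nonneg (by linarith) hη.le)

lemma le_expCutoff {δ η : ℝ} (hη : 0 < η) (s : ℝ) :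
    (Set.Iic δ).indicator Real.exp s ≤ expCutoff (δ + η) η s := by
  by_cases h : s ≤ δ
  · rw [Set.indicator_of_mem (Set.mem_Iic.2 h), expCutoff, min_eq_left, max_eq_right zero_le_one,
      mul_one]
    rw [le_div_iff₀ hη]; linarith
  · rw [Set.indicator_of_notMem (by simpa using h)]
    exact expCutoff_nonneg _ _ _

lemma expCutoff_div_fejerPair_le {δ η : ℝ} (hη : 0 < η) (s : ℝ) :
    expCutoff δ η s / fejerPair s ≤ Real.exp (2 * |δ| + Real.pi) := by
  rw [div_le_iff₀ (fejerPair_pos s)]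
  by_cases h : s ≤ δ
  swap
  · refine (expCutoff_le hη s).trans ?_
    rw [Set.indicator_of_notMem (by simpa using h)]
    have := fejerPair_pos s
    positivity
  have h1 : expCutoff δ η s ≤ Real.exp s := by
    simpa [Set.indicator_of_mem (Set.mem_Iic.2 h)] using expCutoff_le (δ := δ) hη s
  have hq : (|s| + Real.pi) ^ 2 ≤ 4 * Real.exp (|s| + Real.pi) := by
    have := Real.quadratic_le_exp_of_nonneg (x := |s| + Real.pi) (by positivity)
    nlinarith [abs_nonneg s, Real.pi_pos]
  have hs : s ≤ 2 * |δ| - |s| := by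
    rcases le_total 0 s with h0 | h0
    · rw [abs_of_nonneg h0]; linarith [le_abs_self δ]
    · rw [abs_of_nonpos h0]; linarith [abs_nonneg δ]
  have hG := fejerPair_lower_bound s
  have hG2 : 1 ≤ Real.exp (|s| + Real.pi) * fejerPair s := by
    nlinarith [mul_le_mul_of_nonneg_right hq (fejerPair_pos s).le]
  calc expCutoff δ η s ≤ Real.exp s := h1
    _ ≤ Real.exp (2 * |δ| - |s|) := Real.exp_le_exp.2 hs
    _ ≤ Real.exp (2 * |δ| - |s|) * (Real.exp (|s| + Real.pi) * fejerPair s) :=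
        le_mul_of_one_le_right (Real.exp_pos _).le hG2
    _ = _ := by rw [← mul_assoc, ← Real.exp_add]; congr 2; ring

open MeasureTheory in
lemma integrable_indicator_exp (P : Measure ℝ) [IsFiniteMeasure P] (δ : ℝ) :
    Integrable ((Set.Iic δ).indicator Real.exp) P := by
  refine Integrable.of_bound (Real.measurable_exp.indicator measurableSet_Iic).aestronglyMeasurable
    (Real.exp δ) (ae_of_all _ fun s => ?_)
  by_cases h : s ≤ δ
  · rw [Set.indicator_of_mem (Set.mem_Iic.2 h), Real.norm_eq_abs, Real.abs_exp]
    exact Real.exp_le_exp.2 h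
  · rw [Set.indicator_of_notMem (by simpa using h)]
    simpa using (Real.exp_pos δ).le

open MeasureTheory in
lemma integral_indicator_exp (δ : ℝ) : ∫ s, (Set.Iic δ).indicator Real.exp s = Real.exp δ := by
  rw [integral_indicator measurableSet_Iic, integral_exp_Iic]

open MeasureTheory in
lemma integrable_indicator_exp_volume (δ : ℝ) :
    Integrable ((Set.Iic δ).indicator Real.exp) := by
  rw [integrable_indicator_iff measurableSet_Iic]
  exact integrableOn_exp_Iic δ

open MeasureTheory in
/-- A local limit theorem: if the moment generating functions of `ε k • X`, for `X` of law `P k`,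
converge to that of a Gaussian of variance `2a`, and the characteristic functions of `P k` have a
Gaussian bound on every bounded window, then on bounded scales `(ε k)⁻¹ • P k` looks like Lebesgue
measure times the Gaussian density `1 / (2 √(π a))` at the origin. -/
theorem tendsto_integral_indicator_exp {P : ℕ → Measure ℝ} [∀ k, IsProbabilityMeasure (P k)]
    {ε : ℕ → ℝ} {a : ℝ} (ha : 0 < a)
    (hε : ∀ k, 0 < ε k) (hε0 : Tendsto ε atTop (𝓝 0))
    (hchar : ∀ w : ℝ, Tendsto (fun k => charFun (P k) (ε k * w)) atTop
      (𝓝 (Complex.exp (-(a * w ^ 2 : ℝ)))))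
    (hdom : ∀ R : ℝ, 0 < R → ∃ C κ : ℝ, 0 < κ ∧ ∀ᶠ k in atTop, ∀ u : ℝ, |u| ≤ R →
      ‖charFun (P k) u‖ ≤ C * Real.exp (-κ * (u / ε k) ^ 2))
    (δ : ℝ) :
    Tendsto (fun k => (ε k)⁻¹ * ∫ s, (Set.Iic δ).indicator Real.exp s ∂(P k)) atTop
      (𝓝 (Real.exp δ / (2 * Real.sqrt (Real.pi * a)))) := by
  set c : ℝ := Real.sqrt (Real.pi / a) / (2 * Real.pi) with hc
  have hcval : c = 1 / (2 * Real.sqrt (Real.pi * a)) := by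
    rw [hc, Real.sqrt_div Real.pi_pos.le, Real.sqrt_mul Real.pi_pos.le]
    have h1 : Real.sqrt Real.pi ≠ 0 := (Real.sqrt_pos.2 Real.pi_pos).ne'
    have h2 : Real.sqrt a ≠ 0 := (Real.sqrt_pos.2 ha).ne'
    have h3 : Real.sqrt Real.pi ^ 2 = Real.pi := Real.sq_sqrt Real.pi_pos.le
    field_simp
    rw [h3]
  have hcpos : 0 < c := by rw [hcval]; positivity
  have hcut : ∀ δ η : ℝ, 0 < η → Tendsto (fun k => (ε k)⁻¹ * ∫ s, expCutoff δ η s ∂(P k)) atTop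
      (𝓝 (c * ∫ s, expCutoff δ η s)) := by
    intro δ η hη
    let f : BoundedContinuousFunction ℝ ℝ := BoundedContinuousFunction.ofNormedAddCommGroup
      (fun s => expCutoff δ η s / fejerPair s)
      ((continuous_expCutoff δ η).div continuous_fejerPair fun s => (fejerPair_pos s).ne')
      (Real.exp (2 * |δ| + Real.pi)) (fun s => by
        rw [Real.norm_eq_abs, abs_of_nonneg
          (div_nonneg (expCutoff_nonneg _ _ _) (fejerPair_pos s).le)]
        exact expCutoff_div_fejerPair_le hη s)
    have h := tendsto_integral_mul_fejerPair ha hε hε0 hchar hdom f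
    have e : ∀ s, f s * fejerPair s = expCutoff δ η s := fun s =>
      div_mul_cancel₀ _ (fejerPair_pos s).ne'
    simpa only [e] using h
  have hPint : ∀ k δ η, 0 < η → Integrable (expCutoff δ η) (P k) := fun k δ η hη =>
    (integrable_indicator_exp (P k) δ).mono' (continuous_expCutoff δ η).aestronglyMeasurable
      (ae_of_all _ fun s => by
        rw [Real.norm_eq_abs, abs_of_nonneg (expCutoff_nonneg _ _ _)]; exact expCutoff_le hη s)
  have hVint : ∀ δ η, 0 < η → Integrable (expCutoff δ η) := fun δ η hη =>
    (integrable_indicator_exp_volume δ).mono' (continuous_expCutoff δ η).aestronglyMeasurable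
      (ae_of_all _ fun s => by
        rw [Real.norm_eq_abs, abs_of_nonneg (expCutoff_nonneg _ _ _)]; exact expCutoff_le hη s)
  have hup : ∀ δ η, 0 < η → ∫ s, expCutoff δ η s ≤ Real.exp δ := fun δ η hη => by
    rw [← integral_indicator_exp δ]
    exact integral_mono (hVint δ η hη) (integrable_indicator_exp_volume δ) (expCutoff_le hη)
  have hlo : ∀ δ η, 0 < η → Real.exp (δ - η) ≤ ∫ s, expCutoff δ η s := fun δ η hη => by
    rw [← integral_indicator_exp (δ - η)]
    refine integral_mono (integrable_indicator_exp_volume _) (hVint δ η hη) fun s => ?_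
    simpa using le_expCutoff (δ := δ - η) hη s
  have hval : Real.exp δ / (2 * Real.sqrt (Real.pi * a)) = c * Real.exp δ := by
    rw [hcval]; ring
  rw [hval, tendsto_order]
  constructor
  · intro b hb
    have hcont : Tendsto (fun η => c * Real.exp (δ - η)) (𝓝[>] 0) (𝓝 (c * Real.exp (δ - 0))) :=
      ((by fun_prop : Continuous fun η => c * Real.exp (δ - η)).tendsto 0).mono_left
        nhdsWithin_le_nhds
    rw [sub_zero] at hcont
    obtain ⟨η, h1, h2⟩ := ((hcont.eventually (lt_mem_nhds hb)).and self_mem_nhdsWithin).exists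
    have h2 : 0 < η := h2
    have h3 : b < c * ∫ s, expCutoff δ η s :=
      h1.trans_le (mul_le_mul_of_nonneg_left (hlo δ η h2) hcpos.le)
    filter_upwards [(hcut δ η h2).eventually (lt_mem_nhds h3)] with k hk
    refine hk.trans_le (mul_le_mul_of_nonneg_left ?_ (inv_pos.2 (hε k)).le)
    exact integral_mono (hPint k δ η h2) (integrable_indicator_exp _ _) (expCutoff_le h2)
  · intro b hb
    have hcont : Tendsto (fun η => c * Real.exp (δ + η)) (𝓝[>] 0) (𝓝 (c * Real.exp (δ + 0))) :=
      ((by fun_prop : Continuous fun η => c * Real.exp (δ + η)).tendsto 0).mono_left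
        nhdsWithin_le_nhds
    rw [add_zero] at hcont
    obtain ⟨η, h1, h2⟩ := ((hcont.eventually (gt_mem_nhds hb)).and self_mem_nhdsWithin).exists
    have h2 : 0 < η := h2
    have h3 : c * ∫ s, expCutoff (δ + η) η s < b :=
      (mul_le_mul_of_nonneg_left (hup (δ + η) η h2) hcpos.le).trans_lt h1
    filter_upwards [(hcut (δ + η) η h2).eventually (gt_mem_nhds h3)] with k hk
    refine (mul_le_mul_of_nonneg_left ?_ (inv_pos.2 (hε k)).le).trans_lt hk
    exact integral_mono (integrable_indicator_exp _ _) (hPint k (δ + η) η h2) (le_expCutoff h2)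

/-! ### Discrete laws attached to a power series -/

open MeasureTheory in
/-- The measure on `ℝ` with mass `p n` at the point `s n`; negative weights count as zero. -/
noncomputable def discreteLaw (p s : ℕ → ℝ) : Measure ℝ :=
  ((Measure.count : Measure ℕ).withDensity fun n => ENNReal.ofReal (p n)).map s

open MeasureTheory in
lemma integrable_discreteLaw {p s : ℕ → ℝ} (hp : ∀ n, 0 ≤ p n) {E : Type*} [NormedAddCommGroup E]
    [NormedSpace ℝ E] {f : ℝ → E} (hf : StronglyMeasurable f)
    (hs : Summable fun n => p n * ‖f (s n)‖) : Integrable f (discreteLaw p s) := by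
  rw [discreteLaw, integrable_map_measure hf.aestronglyMeasurable
    (measurable_of_countable s).aemeasurable,
    integrable_withDensity_iff_integrable_smul' (measurable_of_countable _)
      (ae_of_all _ fun _ => ENNReal.ofReal_lt_top), integrable_count_iff]
  refine hs.congr fun n => ?_
  rw [ENNReal.toReal_ofReal (hp n), norm_smul, Real.norm_eq_abs, abs_of_nonneg (hp n),
    Function.comp]

open MeasureTheory in
lemma integral_discreteLaw {p s : ℕ → ℝ} (hp : ∀ n, 0 ≤ p n) {E : Type*} [NormedAddCommGroup E]
    [NormedSpace ℝ E] [CompleteSpace E] {f : ℝ → E} (hf : StronglyMeasurable f)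
    (hs : Summable fun n => p n * ‖f (s n)‖) :
    ∫ x, f x ∂(discreteLaw p s) = ∑' n, p n • f (s n) := by
  have e : ∀ n, ‖p n • f (s n)‖ = p n * ‖f (s n)‖ := fun n => by
    rw [norm_smul, Real.norm_eq_abs, abs_of_nonneg (hp n)]
  rw [discreteLaw, integral_map (measurable_of_countable s).aemeasurable hf.aestronglyMeasurable,
    integral_withDensity_eq_integral_toReal_smul (measurable_of_countable _)
      (ae_of_all _ fun _ => ENNReal.ofReal_lt_top)]
  simp only [ENNReal.toReal_ofReal (hp _)]
  rw [integral_countable (integrable_count_iff.2 (hs.congr fun n => (e n).symm))]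
  simp [measureReal_def]

open MeasureTheory in
lemma isProbabilityMeasure_discreteLaw {p s : ℕ → ℝ} (hp : ∀ n, 0 ≤ p n) (h1 : HasSum p 1) :
    IsProbabilityMeasure (discreteLaw p s) := by
  constructor
  rw [discreteLaw, Measure.map_apply (measurable_of_countable s) MeasurableSet.univ,
    Set.preimage_univ, withDensity_apply _ MeasurableSet.univ, Measure.restrict_univ,
    lintegral_count, ← ENNReal.ofReal_tsum_of_nonneg hp h1.summable, h1.tsum_eq, ENNReal.ofReal_one]

/-- The function `t ↦ ∑ bₙ e^{-nt}` of a real variable `t`. -/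
noncomputable def realGenFun (b : ℕ → ℝ) (t : ℝ) : ℝ := ∑' n : ℕ, b n * Real.exp (-(n * t))

lemma summable_mul_exp {b : ℕ → ℝ} (hb : ∀ n, 0 ≤ b n) (hrad : 1 ≤ radiusOfConvergence b)
    {t : ℝ} (ht : 0 < t) : Summable fun n : ℕ => b n * Real.exp (-(n * t)) := by
  let r : NNReal := ⟨Real.exp (-t), (Real.exp_pos _).le⟩
  have hrt : (r : ℝ) = Real.exp (-t) := rfl
  have hr : (r : ENNReal) < (FormalMultilinearSeries.ofScalars ℂ (fun n => (b n : ℂ))).radius := by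
    refine lt_of_lt_of_le ?_ hrad
    rw [ENNReal.coe_lt_one_iff, ← NNReal.coe_lt_coe, hrt]
    simpa using ht
  have h := FormalMultilinearSeries.summable_norm_mul_pow _ hr
  refine h.congr fun n => ?_
  rw [FormalMultilinearSeries.ofScalars_norm, Complex.norm_real, Real.norm_eq_abs,
    abs_of_nonneg (hb n), hrt]
  rw [← Real.exp_nat_mul]; ring_nf

lemma genFun_exp_neg (b : ℕ → ℝ) (z : ℂ) :
    genFun b (Complex.exp (-z)) = ∑' n : ℕ, (b n : ℂ) * Complex.exp (-(n * z)) := by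
  unfold genFun
  congr 1; ext n
  rw [← Complex.exp_nat_mul]; ring_nf

lemma genFun_exp_neg_ofReal (b : ℕ → ℝ) (t : ℝ) :
    genFun b (Complex.exp (-(t : ℂ))) = (realGenFun b t : ℂ) := by
  rw [genFun_exp_neg, realGenFun, Complex.ofReal_tsum]
  congr 1; ext n
  push_cast; rfl

lemma realGenFun_nonneg {b : ℕ → ℝ} (hb : ∀ n, 0 ≤ b n) (t : ℝ) : 0 ≤ realGenFun b t :=
  tsum_nonneg fun n => mul_nonneg (hb n) (Real.exp_pos _).le

open MeasureTheory in
/-- The law of `nt - γ/t` when `n` is random with probability proportional to `bₙ e^{-nt}`. The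
centring places the saddle point `n = γ/t²` of `e^{γ/t + nt}` at the origin. -/
noncomputable def saddleLaw (b : ℕ → ℝ) (γ t : ℝ) : Measure ℝ :=
  discreteLaw (fun n => b n * Real.exp (-(n * t)) / realGenFun b t) (fun n => n * t - γ / t)

section SaddleLaw

variable {b : ℕ → ℝ} {γ t : ℝ}

lemma saddleLaw_weight_nonneg (hb : ∀ n, 0 ≤ b n) (t : ℝ) (n : ℕ) :
    0 ≤ b n * Real.exp (-(n * t)) / realGenFun b t :=
  div_nonneg (mul_nonneg (hb n) (Real.exp_pos _).le) (realGenFun_nonneg hb t)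

open MeasureTheory in
lemma isProbabilityMeasure_saddleLaw (hb : ∀ n, 0 ≤ b n) (hrad : 1 ≤ radiusOfConvergence b)
    (ht : 0 < t) (hB : 0 < realGenFun b t) : IsProbabilityMeasure (saddleLaw b γ t) := by
  refine isProbabilityMeasure_discreteLaw (saddleLaw_weight_nonneg hb t) ?_
  have := (summable_mul_exp hb hrad ht).hasSum.div_const (realGenFun b t)
  rwa [← realGenFun, div_self hB.ne'] at this

lemma summable_saddleLaw_mul_exp (hb : ∀ n, 0 ≤ b n) (hrad : 1 ≤ radiusOfConvergence b)
    (ht : 0 < t) {v : ℝ} (hv : v < 1) : Summable fun n : ℕ =>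
      b n * Real.exp (-(n * t)) / realGenFun b t * Real.exp (v * (n * t - γ / t)) := by
  have h := (summable_mul_exp hb hrad (t := t * (1 - v)) (mul_pos ht (by linarith))).mul_right
    (Real.exp (-(v * (γ / t))) / realGenFun b t)
  refine h.congr fun n => ?_
  have e : Real.exp (-(n * t)) * Real.exp (v * (n * t - γ / t))
      = Real.exp (-(n * (t * (1 - v)))) * Real.exp (-(v * (γ / t))) := by
    rw [← Real.exp_add, ← Real.exp_add]; congr 1; ring
  linear_combination -(b n / realGenFun b t) * e

open MeasureTheory ProbabilityTheory in
lemma mem_integrableExpSet_saddleLaw (hb : ∀ n, 0 ≤ b n) (hrad : 1 ≤ radiusOfConvergence b)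
    (ht : 0 < t) {v : ℝ} (hv : v < 1) : v ∈ integrableExpSet id (saddleLaw b γ t) := by
  refine integrable_discreteLaw (saddleLaw_weight_nonneg hb t)
    (f := fun x : ℝ => Real.exp (v * x)) (by fun_prop) ?_
  simpa using summable_saddleLaw_mul_exp hb hrad ht hv

open MeasureTheory ProbabilityTheory in
lemma mgf_saddleLaw (hb : ∀ n, 0 ≤ b n) (hrad : 1 ≤ radiusOfConvergence b)
    (ht : 0 < t) {v : ℝ} (hv : v < 1) :
    mgf id (saddleLaw b γ t) v
      = Real.exp (-(v * (γ / t))) * realGenFun b (t * (1 - v)) / realGenFun b t := by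
  have h := integral_discreteLaw (saddleLaw_weight_nonneg hb t) (s := fun n => n * t - γ / t)
    (f := fun x : ℝ => Real.exp (v * x)) (by fun_prop)
    (by simpa using summable_saddleLaw_mul_exp hb hrad ht hv)
  refine h.trans ?_
  rw [mul_div_right_comm, show realGenFun b (t * (1 - v)) =
    ∑' n : ℕ, b n * Real.exp (-(n * (t * (1 - v)))) from rfl, ← tsum_mul_left]
  congr 1; ext n
  have e : Real.exp (-(n * t)) * Real.exp (v * (n * t - γ / t))
      = Real.exp (-(n * (t * (1 - v)))) * Real.exp (-(v * (γ / t))) := by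
    rw [← Real.exp_add, ← Real.exp_add]; congr 1; ring
  rw [smul_eq_mul]
  linear_combination (b n / realGenFun b t) * e

open MeasureTheory in
lemma norm_charFun_saddleLaw (hb : ∀ n, 0 ≤ b n) (hrad : 1 ≤ radiusOfConvergence b)
    (ht : 0 < t) (u : ℝ) :
    ‖charFun (saddleLaw b γ t) u‖
      = ‖genFun b (Complex.exp (-(t * (1 - u * Complex.I))))‖ / realGenFun b t := by
  have h := integral_discreteLaw (saddleLaw_weight_nonneg hb t) (s := fun n => n * t - γ / t)
    (f := fun x : ℝ => Complex.exp (u * x * Complex.I))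
    (by fun_prop : Continuous fun x : ℝ => Complex.exp (u * x * Complex.I)).stronglyMeasurable (by
      have e : ∀ x y : ℝ, ‖Complex.exp (x * y * Complex.I)‖ = 1 := fun x y => by
        rw [← Complex.ofReal_mul, Complex.norm_exp_ofReal_mul_I]
      simp only [e, mul_one]
      exact (summable_mul_exp hb hrad ht).div_const _)
  have h2 : charFun (saddleLaw b γ t) u = Complex.exp ((-(u * (γ / t)) : ℝ) * Complex.I) *
      (genFun b (Complex.exp (-(t * (1 - u * Complex.I)))) / realGenFun b t) := by
    rw [charFun_apply_real]
    refine h.trans ?_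
    rw [genFun_exp_neg, ← tsum_div_const, ← tsum_mul_left]
    congr 1; ext n
    have e : Complex.exp (-(n * t)) * Complex.exp (u * (n * t - γ / t : ℝ) * Complex.I)
        = Complex.exp ((-(u * (γ / t)) : ℝ) * Complex.I) *
          Complex.exp (-(n * (t * (1 - u * Complex.I)))) := by
      rw [← Complex.exp_add, ← Complex.exp_add]; congr 1; push_cast; ring
    rw [Complex.real_smul]
    push_cast at e ⊢
    linear_combination ((b n : ℂ) / realGenFun b t) * e
  rw [h2, norm_mul, Complex.norm_exp_ofReal_mul_I, one_mul, norm_div, Complex.norm_real,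
    Real.norm_eq_abs, abs_of_nonneg (realGenFun_nonneg hb t)]

/-- The summatory function `∑_{n ≤ x} bₙ`, meaningful for `x ≥ 0`. -/
noncomputable def partialSum (b : ℕ → ℝ) (x : ℝ) : ℝ := ∑ n ∈ Finset.range (⌊x⌋₊ + 1), b n

open MeasureTheory in
lemma integral_indicator_exp_saddleLaw (hb : ∀ n, 0 ≤ b n) (ht : 0 < t) {δ : ℝ}
    (hδ : 0 ≤ (γ / t + δ) / t) :
    ∫ s, (Set.Iic δ).indicator Real.exp s ∂(saddleLaw b γ t)
      = Real.exp (-(γ / t)) / realGenFun b t * partialSum b ((γ / t + δ) / t) := by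
  have hiff : ∀ n : ℕ, n ∈ Finset.range (⌊(γ / t + δ) / t⌋₊ + 1) ↔ n * t - γ / t ≤ δ := fun n => by
    rw [Finset.mem_range, Nat.lt_succ_iff, Nat.le_floor_iff hδ, le_div_iff₀ ht]
    constructor <;> intro h <;> linarith
  have hzero : ∀ n : ℕ, n ∉ Finset.range (⌊(γ / t + δ) / t⌋₊ + 1) →
      (Set.Iic δ).indicator Real.exp (n * t - γ / t) = 0 := fun n hn =>
    Set.indicator_of_notMem (s := Set.Iic δ) (fun h => hn ((hiff n).2 h)) _
  have h := integral_discreteLaw (saddleLaw_weight_nonneg hb t) (s := fun n => n * t - γ / t)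
    (f := (Set.Iic δ).indicator Real.exp)
    (Real.measurable_exp.indicator measurableSet_Iic).stronglyMeasurable
    (summable_of_ne_finset_zero (s := Finset.range (⌊(γ / t + δ) / t⌋₊ + 1)) fun n hn => by
      rw [hzero n hn]; simp)
  refine h.trans ?_
  rw [tsum_eq_sum (s := Finset.range (⌊(γ / t + δ) / t⌋₊ + 1)) fun n hn => by
      rw [hzero n hn]; simp, partialSum, Finset.mul_sum]
  refine Finset.sum_congr rfl fun n hn => ?_
  rw [Set.indicator_of_mem (Set.mem_Iic.2 ((hiff n).1 hn)), smul_eq_mul, div_mul_eq_mul_div,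
    mul_assoc, ← Real.exp_add]
  have : -(n * t) + (n * t - γ / t) = -(γ / t) := by ring
  rw [this]; ring

end SaddleLaw

/-! ### Growth of the power series near the boundary point `q = 1` -/

/-- The comparison function `log(1/t)^α t^β e^{γ/t}`. -/
noncomputable def growth (α β γ t : ℝ) : ℝ :=
  Real.log (1 / t) ^ α * t ^ β * Real.exp (γ / t)

section Growth

variable {α β γ : ℝ}

lemma log_one_div_pos {t : ℝ} (ht : 0 < t) (ht1 : t < 1) : 0 < Real.log (1 / t) :=
  Real.log_pos (by rw [one_div]; exact (one_lt_inv₀ ht).2 ht1)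

lemma growth_pos {t : ℝ} (ht : 0 < t) (ht1 : t < 1) : 0 < growth α β γ t := by
  have := log_one_div_pos ht ht1
  unfold growth; positivity

lemma growth_mul_div_growth {t r : ℝ} (ht : 0 < t) (ht1 : t < 1) (hr : 0 < r) (hr1 : t * r < 1) :
    growth α β γ (t * r) / growth α β γ t
      = (Real.log (1 / (t * r)) / Real.log (1 / t)) ^ α * r ^ β *
        Real.exp (γ / t * (1 / r - 1)) := by
  have h1 := log_one_div_pos ht ht1
  have h2 := log_one_div_pos (mul_pos ht hr) hr1
  have e : γ / t * (1 / r - 1) = γ / (t * r) - γ / t := by field_simp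
  rw [e, Real.exp_sub, Real.div_rpow h2.le h1.le, growth, growth, Real.mul_rpow ht.le hr.le]
  have h3 := (Real.rpow_pos_of_pos h1 α).ne'
  have h4 := (Real.rpow_pos_of_pos ht β).ne'
  field_simp

lemma log_one_div_mul {t r : ℝ} (ht : 0 < t) (hr : 0 < r) :
    Real.log (1 / (t * r)) = Real.log (1 / t) - Real.log r := by
  rw [one_div, one_div, Real.log_inv, Real.log_inv, Real.log_mul ht.ne' hr.ne']; ring

lemma tendsto_log_one_div : Tendsto (fun t : ℝ => Real.log (1 / t)) (𝓝[>] 0) atTop := by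
  simp only [one_div]
  exact Real.tendsto_log_atTop.comp tendsto_inv_nhdsGT_zero

/-- Along `r = 1 - v √t` the exponent is `γ/t (1/r - 1) = γ v / √t + γ v² / r`: the first term is
removed by the centring, and the second converges. -/
lemma tendsto_centred_growth_ratio (v : ℝ) :
    Tendsto (fun t : ℝ => Real.exp (-(Real.sqrt t * v * (γ / t))) *
      (growth α β γ (t * (1 - Real.sqrt t * v)) / growth α β γ t)) (𝓝[>] 0)
      (𝓝 (Real.exp (γ * v ^ 2))) := by
  have hid : Tendsto (fun t : ℝ => t) (𝓝[>] 0) (𝓝 0) := nhdsWithin_le_nhds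
  have hr : Tendsto (fun t : ℝ => 1 - Real.sqrt t * v) (𝓝[>] 0) (𝓝 1) := by
    have : Tendsto (fun t : ℝ => 1 - Real.sqrt t * v) (𝓝[>] 0) (𝓝 (1 - Real.sqrt 0 * v)) :=
      ((by fun_prop : Continuous fun t : ℝ => 1 - Real.sqrt t * v).tendsto 0).mono_left
        nhdsWithin_le_nhds
    simpa using this
  have hlog : Tendsto (fun t : ℝ => 1 - Real.log (1 - Real.sqrt t * v) / Real.log (1 / t))
      (𝓝[>] 0) (𝓝 1) := by
    have h1 : Tendsto (fun t : ℝ => Real.log (1 - Real.sqrt t * v)) (𝓝[>] 0) (𝓝 (Real.log 1)) :=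
      (Real.continuousAt_log one_ne_zero).tendsto.comp hr
    simpa using (h1.div_atTop tendsto_log_one_div).const_sub 1
  have hlim : Tendsto (fun t : ℝ =>
      (1 - Real.log (1 - Real.sqrt t * v) / Real.log (1 / t)) ^ α * (1 - Real.sqrt t * v) ^ β *
        Real.exp (γ * v ^ 2 / (1 - Real.sqrt t * v))) (𝓝[>] 0)
      (𝓝 (1 ^ α * 1 ^ β * Real.exp (γ * v ^ 2 / 1))) := by
    refine Tendsto.mul (Tendsto.mul (hlog.rpow_const (Or.inl one_ne_zero))
      (hr.rpow_const (Or.inl one_ne_zero))) ?_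
    exact (Real.continuous_exp.tendsto _).comp (tendsto_const_nhds.div hr one_ne_zero)
  simp only [Real.one_rpow, one_mul, div_one] at hlim
  refine hlim.congr' ?_
  have htr : Tendsto (fun t : ℝ => t * (1 - Real.sqrt t * v)) (𝓝[>] 0) (𝓝 0) := by
    simpa using hid.mul hr
  filter_upwards [self_mem_nhdsWithin, hid.eventually (gt_mem_nhds one_pos),
    hr.eventually (lt_mem_nhds one_pos), htr.eventually (gt_mem_nhds one_pos)] with t ht ht1 hr0 hr1
  have ht : 0 < t := ht
  have hL := log_one_div_pos ht ht1
  rw [growth_mul_div_growth ht ht1 hr0 hr1, log_one_div_mul ht hr0, sub_div, div_self hL.ne']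
  have hs : 0 < Real.sqrt t := Real.sqrt_pos.2 ht
  have hsq : Real.sqrt t ^ 2 = t := Real.sq_sqrt ht.le
  have e : γ * v ^ 2 / (1 - Real.sqrt t * v)
      = -(Real.sqrt t * v * (γ / t)) + γ / t * (1 / (1 - Real.sqrt t * v) - 1) := by
    generalize Real.sqrt t = s at hs hsq hr0
    subst hsq
    have h1 : 1 / (1 - s * v) * (1 - s * v) = 1 := one_div_mul_cancel hr0.ne'
    obtain ⟨g, hg⟩ : ∃ g, γ / s ^ 2 = g := ⟨_, rfl⟩
    have h2 : γ = g * s ^ 2 := by rw [← hg]; field_simp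
    rw [div_eq_mul_one_div (γ * v ^ 2), hg, h2]
    linear_combination (-g - g * s * v) * h1
  rw [e, Real.exp_add]
  ring

end Growth

section Asymptotics

variable {b : ℕ → ℝ} {lam α β γ : ℝ}

lemma tendsto_centred_realGenFun_ratio (hlam : 0 < lam)
    (hB : Tendsto (fun t => realGenFun b t / growth α β γ t) (𝓝[>] 0) (𝓝 lam)) (v : ℝ) :
    Tendsto (fun t : ℝ => Real.exp (-(Real.sqrt t * v * (γ / t))) *
      realGenFun b (t * (1 - Real.sqrt t * v)) / realGenFun b t) (𝓝[>] 0)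
      (𝓝 (Real.exp (γ * v ^ 2))) := by
  have hid : Tendsto (fun t : ℝ => t) (𝓝[>] 0) (𝓝 0) := nhdsWithin_le_nhds
  have hr : Tendsto (fun t : ℝ => 1 - Real.sqrt t * v) (𝓝[>] 0) (𝓝 1) := by
    have : Tendsto (fun t : ℝ => 1 - Real.sqrt t * v) (𝓝[>] 0) (𝓝 (1 - Real.sqrt 0 * v)) :=
      ((by fun_prop : Continuous fun t : ℝ => 1 - Real.sqrt t * v).tendsto 0).mono_left
        nhdsWithin_le_nhds
    simpa using this
  have htr : Tendsto (fun t : ℝ => t * (1 - Real.sqrt t * v)) (𝓝[>] 0) (𝓝[>] 0) := by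
    refine tendsto_nhdsWithin_iff.2 ⟨by simpa using hid.mul hr, ?_⟩
    filter_upwards [self_mem_nhdsWithin, hr.eventually (lt_mem_nhds one_pos)] with t ht h1
    exact mul_pos ht h1
  have h1 := (hB.comp htr).div hB hlam.ne'
  rw [div_self hlam.ne'] at h1
  have h2 := h1.mul (tendsto_centred_growth_ratio (α := α) (β := β) (γ := γ) v)
  rw [one_mul] at h2
  refine h2.congr' ?_
  have hnz : ∀ᶠ t in 𝓝[>] (0 : ℝ), growth α β γ t ≠ 0 := by
    filter_upwards [self_mem_nhdsWithin, hid.eventually (gt_mem_nhds one_pos)] with t ht h1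
    exact (growth_pos ht h1).ne'
  filter_upwards [hnz, htr.eventually hnz] with t ht ht2
  simp only [Pi.div_apply, Function.comp]
  by_cases h0 : realGenFun b t = 0
  · simp [h0]
  · field_simp

/-- On the segment `z = t (1 - i u)` the factor `e^{γ/|z|}` in the bound is smaller than `e^{γ/t}`
by a Gaussian factor in `u / √t`, because `1 - 1 / √(1 + u²)` is bounded below by a multiple of
`u²`. -/
lemma eventually_norm_genFun_le (hγ : 0 < γ) (hlam : 0 < lam)
    (hB : Tendsto (fun t => realGenFun b t / growth α β γ t) (𝓝[>] 0) (𝓝 lam))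
    (hcone : ∀ Δ : ℝ, 0 < Δ →
      (fun z : ℂ => genFun b (Complex.exp (-z))) =O[𝓝[cone Δ] (0 : ℂ)]
        (fun z : ℂ => growth α β γ ‖z‖)) (R : ℝ) (hR : 0 < R) :
    ∃ C κ : ℝ, 0 < κ ∧ ∀ᶠ t : ℝ in 𝓝[>] 0, ∀ u : ℝ, |u| ≤ R →
      ‖genFun b (Complex.exp (-(t * (1 - u * Complex.I))))‖ / realGenFun b t
        ≤ C * Real.exp (-κ * (u / Real.sqrt t) ^ 2) := by
  obtain ⟨C₀, hC₀, hbound⟩ := (hcone R hR).exists_pos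
  rw [IsBigOWith, eventually_nhdsWithin_iff, Metric.eventually_nhds_iff] at hbound
  obtain ⟨ρ, hρ, hbound⟩ := hbound
  refine ⟨C₀ * (2 ^ |α| * (1 + R) ^ |β|) * (2 / lam), γ / (2 * (1 + R) ^ 2), by positivity, ?_⟩
  have hid : Tendsto (fun t : ℝ => t) (𝓝[>] 0) (𝓝 0) := nhdsWithin_le_nhds
  have htR : Tendsto (fun t : ℝ => t * (1 + R)) (𝓝[>] 0) (𝓝 0) := by
    simpa using hid.mul_const (1 + R)
  filter_upwards [self_mem_nhdsWithin, hid.eventually (gt_mem_nhds one_pos),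
    htR.eventually (gt_mem_nhds (lt_min hρ one_pos)),
    tendsto_log_one_div.eventually (eventually_ge_atTop (2 * Real.log (1 + R))),
    hB.eventually (lt_mem_nhds (half_lt_self hlam))] with t ht ht1 htρ hlog hBt u hu
  have ht : 0 < t := ht
  set q : ℝ := Real.sqrt (1 + u ^ 2) with hq
  have hq2 : q ^ 2 = 1 + u ^ 2 := Real.sq_sqrt (by positivity)
  have hq0 : 0 < q := Real.sqrt_pos.2 (by positivity)
  have hq1 : 1 ≤ q := by nlinarith [sq_nonneg u]
  have hqR : q ≤ 1 + R := by
    have : u ^ 2 ≤ R ^ 2 := by rw [← sq_abs u]; gcongr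
    nlinarith
  have htq : t * q < min ρ 1 := (mul_le_mul_of_nonneg_left hqR ht.le).trans_lt htρ
  have hnorm : ‖(t : ℂ) * (1 - u * Complex.I)‖ = t * q := by
    rw [norm_mul, Complex.norm_real, Real.norm_eq_abs, abs_of_pos ht, hq]
    congr 1
    have : (1 : ℂ) - u * Complex.I = ((1 : ℝ) : ℂ) + ((-u : ℝ) : ℂ) * Complex.I := by
      push_cast; ring
    rw [this, Complex.norm_add_mul_I]
    congr 1; ring
  have hmem : (t : ℂ) * (1 - u * Complex.I) ∈ cone R := by
    constructor
    · simpa using ht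
    · have : ((t : ℂ) * (1 - u * Complex.I)).im = -(t * u) := by simp
      have h2 : ((t : ℂ) * (1 - u * Complex.I)).re = t := by simp
      rw [this, h2, abs_neg, abs_mul, abs_of_pos ht, mul_comm]
      gcongr
  have hg := growth_pos (α := α) (β := β) (γ := γ) ht ht1
  have h1 := hbound (y := (t : ℂ) * (1 - u * Complex.I))
    (by rw [dist_zero_right, hnorm]; exact htq.trans_le (min_le_left _ _)) hmem
  have hgq := growth_pos (α := α) (β := β) (γ := γ) (mul_pos ht hq0)
    (htq.trans_le (min_le_right _ _))
  rw [hnorm, Real.norm_eq_abs, abs_of_pos hgq] at h1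
  have hBpos : lam / 2 * growth α β γ t < realGenFun b t := (lt_div_iff₀ hg).1 hBt
  have hBpos0 : 0 < realGenFun b t := lt_trans (by positivity) hBpos
  have hratio : growth α β γ (t * q) / growth α β γ t
      ≤ 2 ^ |α| * (1 + R) ^ |β| * Real.exp (-(γ / (2 * (1 + R) ^ 2)) * (u / Real.sqrt t) ^ 2) := by
    rw [growth_mul_div_growth ht ht1 hq0 (htq.trans_le (min_le_right _ _))]
    have hL := log_one_div_pos ht ht1
    gcongr ?_ * ?_ * Real.exp ?_
    · have hx1 : Real.log (1 / (t * q)) / Real.log (1 / t) ≤ 1 := by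
        rw [div_le_one hL, log_one_div_mul ht hq0]
        linarith [Real.log_nonneg hq1]
      have hx2 : 2⁻¹ ≤ Real.log (1 / (t * q)) / Real.log (1 / t) := by
        rw [le_div_iff₀ hL, log_one_div_mul ht hq0]
        linarith [Real.log_le_log hq0 hqR]
      have hx0 : 0 < Real.log (1 / (t * q)) / Real.log (1 / t) := lt_of_lt_of_le (by norm_num) hx2
      calc (Real.log (1 / (t * q)) / Real.log (1 / t)) ^ α
          ≤ (Real.log (1 / (t * q)) / Real.log (1 / t)) ^ (-|α|) :=
            Real.rpow_le_rpow_of_exponent_ge hx0 hx1 (neg_abs_le α)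
        _ ≤ (2⁻¹ : ℝ) ^ (-|α|) :=
            Real.rpow_le_rpow_of_nonpos (by norm_num) hx2 (by simp)
        _ = 2 ^ |α| := by rw [Real.inv_rpow (by norm_num), Real.rpow_neg (by norm_num), inv_inv]
    · calc q ^ β ≤ q ^ |β| := Real.rpow_le_rpow_of_exponent_le hq1 (le_abs_self β)
        _ ≤ (1 + R) ^ |β| := by gcongr
    · rw [div_pow, Real.sq_sqrt ht.le]
      have h3 : 1 / q - 1 ≤ -(u ^ 2 / (2 * (1 + R) ^ 2)) := by
        have h4 : 1 / q - 1 = -(u ^ 2 / (q * (q + 1))) := by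
          have : u ^ 2 = q ^ 2 - 1 := by linarith
          rw [this]; field_simp; ring
        rw [h4]
        exact neg_le_neg (div_le_div_of_nonneg_left (by positivity) (by positivity) (by nlinarith))
      calc γ / t * (1 / q - 1) ≤ γ / t * (-(u ^ 2 / (2 * (1 + R) ^ 2))) := by gcongr
        _ = _ := by field_simp
  rw [div_le_iff₀ hBpos0]
  set K := 2 ^ |α| * (1 + R) ^ |β| with hK
  set e := Real.exp (-(γ / (2 * (1 + R) ^ 2)) * (u / Real.sqrt t) ^ 2) with he
  have hK0 : 0 < K := by positivity
  have he0 : 0 < e := Real.exp_pos _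
  rw [div_le_iff₀ hg] at hratio
  calc _ ≤ C₀ * growth α β γ (t * q) := h1
    _ ≤ C₀ * (K * e * growth α β γ t) := by gcongr
    _ = C₀ * K * (2 / lam) * e * (lam / 2 * growth α β γ t) := by field_simp
    _ ≤ C₀ * K * (2 / lam) * e * realGenFun b t := by gcongr

open MeasureTheory ProbabilityTheory in
/-- The saddle point asymptotic: `∑_{n ≤ (γ/t + δ)/t} bₙ ∼ √t B(e^{-t}) e^{γ/t} e^δ / (2 √(π γ))`,
along any sequence `t → 0⁺`. -/
theorem tendsto_partialSum_saddle (hb : ∀ n, 0 ≤ b n) (hrad : 1 ≤ radiusOfConvergence b)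
    (hγ : 0 < γ) (hlam : 0 < lam)
    (hB : Tendsto (fun t => realGenFun b t / growth α β γ t) (𝓝[>] 0) (𝓝 lam))
    (hcone : ∀ Δ : ℝ, 0 < Δ →
      (fun z : ℂ => genFun b (Complex.exp (-z))) =O[𝓝[cone Δ] (0 : ℂ)]
        (fun z : ℂ => growth α β γ ‖z‖))
    {t : ℕ → ℝ} (ht : ∀ k, 0 < t k) (ht0 : Tendsto t atTop (𝓝 0)) (δ : ℝ) :
    Tendsto (fun k => partialSum b ((γ / t k + δ) / t k) /
        (Real.sqrt (t k) * realGenFun b (t k) * Real.exp (γ / t k)))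
      atTop (𝓝 (Real.exp δ / (2 * Real.sqrt (Real.pi * γ)))) := by
  have htw : Tendsto t atTop (𝓝[>] 0) :=
    tendsto_nhdsWithin_iff.2 ⟨ht0, Eventually.of_forall ht⟩
  have hBpos : ∀ s, 0 < s → 0 < realGenFun b s := by
    -- A vanishing value at one point would force all coefficients to vanish.
    intro s hs
    refine lt_of_le_of_ne (realGenFun_nonneg hb s) fun h0 => ?_
    have hz : ∀ n, b n = 0 := fun n => by
      have h1 := (hasSum_zero_iff_of_nonneg (fun n => mul_nonneg (hb n) (Real.exp_pos _).le)).1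
        (h0 ▸ (summable_mul_exp hb hrad hs).hasSum : HasSum (fun n : ℕ => b n * Real.exp (-(n * s))) 0)
      simpa using congrFun h1 n
    have h2 : Tendsto (fun t => realGenFun b t / growth α β γ t) (𝓝[>] 0) (𝓝 0) := by
      simp [realGenFun, hz]
    exact hlam.ne (tendsto_nhds_unique h2 hB)
  have : ∀ k, IsProbabilityMeasure (saddleLaw b γ (t k)) := fun k =>
    isProbabilityMeasure_saddleLaw hb hrad (ht k) (hBpos _ (ht k))
  have hs0 : Tendsto (fun k => Real.sqrt (t k)) atTop (𝓝 0) := by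
    simpa [Function.comp_def] using (Real.continuous_sqrt.tendsto 0).comp ht0
  have hsv : ∀ v : ℝ, ∀ᶠ k in atTop, Real.sqrt (t k) * v < 1 := fun v =>
    (by simpa using hs0.mul_const v : Tendsto (fun k => Real.sqrt (t k) * v) atTop (𝓝 0)).eventually
      (gt_mem_nhds one_pos)
  have hchar : ∀ w : ℝ, Tendsto (fun k => charFun (saddleLaw b γ (t k)) (Real.sqrt (t k) * w)) atTop
      (𝓝 (Complex.exp (-(γ * w ^ 2 : ℝ)))) := by
    intro w
    simp_rw [← charFun_map_mul]
    refine tendsto_charFun_of_tendsto_mgf (fun v => ?_) (fun v => ?_) w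
    · filter_upwards [hsv v] with k hk
      have h := mem_integrableExpSet_saddleLaw (γ := γ) hb hrad (ht k) hk
      change Integrable _ _ at h ⊢
      rw [integrable_map_measure (by fun_prop) (by fun_prop)]
      refine h.congr (ae_of_all _ fun x => ?_)
      simp only [Function.comp, id]
      congr 1; ring
    · refine ((tendsto_centred_realGenFun_ratio hlam hB v).comp htw).congr' ?_
      filter_upwards [hsv v] with k hk
      rw [mgf_id_map (by fun_prop)]
      have h := mgf_saddleLaw (γ := γ) hb hrad (ht k) hk
      have e : mgf (fun x => Real.sqrt (t k) * x) (saddleLaw b γ (t k)) v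
          = mgf id (saddleLaw b γ (t k)) (Real.sqrt (t k) * v) := by
        unfold mgf
        congr 1; ext x
        simp only [id]
        congr 1; ring
      rw [e, h]
      rfl
  have hdom : ∀ R : ℝ, 0 < R → ∃ C κ : ℝ, 0 < κ ∧ ∀ᶠ k in atTop, ∀ u : ℝ, |u| ≤ R →
      ‖charFun (saddleLaw b γ (t k)) u‖ ≤ C * Real.exp (-κ * (u / Real.sqrt (t k)) ^ 2) := by
    intro R hR
    obtain ⟨C, κ, hκ, h⟩ := eventually_norm_genFun_le hγ hlam hB hcone R hR
    refine ⟨C, κ, hκ, ?_⟩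
    filter_upwards [htw.eventually h] with k hk u hu
    rw [norm_charFun_saddleLaw hb hrad (ht k)]
    exact hk u hu
  have hmain := tendsto_integral_indicator_exp hγ (fun k => Real.sqrt_pos.2 (ht k)) hs0 hchar hdom δ
  refine hmain.congr' ?_
  have hpos : ∀ᶠ k in atTop, t k * δ > -γ := by
    have : Tendsto (fun k => t k * δ) atTop (𝓝 0) := by simpa using ht0.mul_const δ
    exact this.eventually (lt_mem_nhds (by linarith))
  filter_upwards [hpos] with k hk
  have htk := ht k
  rw [integral_indicator_exp_saddleLaw hb htk, Real.exp_neg]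
  · field_simp
  · have : γ / t k + δ = (γ + t k * δ) / t k := by field_simp
    rw [this]
    have : 0 ≤ γ + t k * δ := by linarith
    positivity

end Asymptotics

/-! ### Evaluation at the saddle point -/

/-- The saddle point `√(γ/N)` of `e^{γ/t + Nt}`. -/
noncomputable def saddle (γ : ℝ) (N : ℕ) : ℝ := Real.sqrt (γ / N)

section Saddle

variable {γ : ℝ}

lemma saddle_pos (hγ : 0 < γ) {N : ℕ} (hN : 0 < N) : 0 < saddle γ N := by
  unfold saddle; positivity

lemma tendsto_saddle (γ : ℝ) : Tendsto (saddle γ) atTop (𝓝 0) := by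
  have h : Tendsto (fun N : ℕ => γ / (N : ℝ)) atTop (𝓝 0) := tendsto_const_div_atTop_nhds_zero_nat γ
  have h1 := (Real.continuous_sqrt.tendsto 0).comp h
  rwa [Real.sqrt_zero] at h1

lemma div_saddle_div_saddle (hγ : 0 < γ) {N : ℕ} (hN : 0 < N) :
    γ / saddle γ N / saddle γ N = N := by
  have hN' : (0 : ℝ) < N := by exact_mod_cast hN
  rw [div_div, saddle, Real.mul_self_sqrt (by positivity)]
  field_simp

lemma div_saddle (hγ : 0 < γ) {N : ℕ} (hN : 0 < N) : γ / saddle γ N = Real.sqrt (γ * N) := by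
  have h := div_saddle_div_saddle hγ hN
  have ht := saddle_pos hγ hN
  rw [eq_comm, Real.sqrt_eq_iff_mul_self_eq (by positivity) (by positivity), ← h]
  ring

/-- The normalisation `√t B(e^{-t}) e^{γ/t}` at the saddle point `t = √(γ/N)`. -/
noncomputable def saddleScale (b : ℕ → ℝ) (γ : ℝ) (N : ℕ) : ℝ :=
  Real.sqrt (saddle γ N) * realGenFun b (saddle γ N) * Real.exp (γ / saddle γ N)

/-- The asymptotic value of the partial sums. -/
noncomputable def partialSumAsymptotic (lam α β γ : ℝ) (N : ℕ) : ℝ :=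
  lam * γ ^ (β / 2 - 1 / 4) * Real.log (N : ℝ) ^ α /
    ((2 : ℝ) ^ (α + 1) * Real.sqrt Real.pi * (N : ℝ) ^ (β / 2 + 1 / 4)) *
      Real.exp (2 * Real.sqrt (γ * N))

lemma partialSumAsymptotic_eq {lam α β : ℝ} (hγ : 0 < γ) {N : ℕ} (hN : 1 < N)
    (ht1 : saddle γ N < 1) :
    partialSumAsymptotic lam α β γ N
      = 1 / (2 * Real.sqrt (Real.pi * γ)) * lam *
        (Real.log N / 2 / Real.log (1 / saddle γ N)) ^ α *
        (Real.sqrt (saddle γ N) * growth α β γ (saddle γ N) * Real.exp (γ / saddle γ N)) := by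
  have hN0 : 0 < N := by omega
  have hNr : (1 : ℝ) < N := by exact_mod_cast hN
  have hNr0 : (0 : ℝ) < N := by linarith
  have ht := saddle_pos hγ hN0
  have hL := log_one_div_pos ht ht1
  have hl : 0 < Real.log N := Real.log_pos hNr
  have hpow : Real.sqrt (saddle γ N) * saddle γ N ^ β
      = γ ^ (β / 2 - 1 / 4) * Real.sqrt γ / (N : ℝ) ^ (β / 2 + 1 / 4) := by
    rw [Real.sqrt_eq_rpow (saddle γ N), ← Real.rpow_add ht, saddle,
      Real.sqrt_eq_rpow, ← Real.rpow_mul (by positivity), Real.div_rpow hγ.le hNr0.le,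
      Real.sqrt_eq_rpow, ← Real.rpow_add hγ]
    congr 2 <;> ring
  have hexp : Real.exp (2 * Real.sqrt (γ * N)) = Real.exp (γ / saddle γ N) ^ 2 := by
    rw [div_saddle hγ hN0, ← Real.exp_nat_mul]; norm_num
  have hsplit : Real.sqrt (saddle γ N) * growth α β γ (saddle γ N) * Real.exp (γ / saddle γ N)
      = Real.log (1 / saddle γ N) ^ α * (Real.sqrt (saddle γ N) * saddle γ N ^ β) *
        Real.exp (γ / saddle γ N) ^ 2 := by
    unfold growth; ring
  rw [hsplit, hpow, partialSumAsymptotic, hexp, Real.div_rpow (by positivity) hL.le,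
    Real.div_rpow hl.le (by norm_num), Real.sqrt_mul Real.pi_pos.le,
    Real.rpow_add (by norm_num), Real.rpow_one]
  have h1 := (Real.rpow_pos_of_pos hL α).ne'
  have h2 : Real.sqrt γ ≠ 0 := (Real.sqrt_pos.2 hγ).ne'
  have h3 : Real.sqrt Real.pi ≠ 0 := (Real.sqrt_pos.2 Real.pi_pos).ne'
  have h4 := (Real.rpow_pos_of_pos hNr0 (β / 2 + 1 / 4)).ne'
  have h5 := (Real.rpow_pos_of_pos (two_pos (α := ℝ)) α).ne'
  field_simp

lemma tendsto_log_div_log_saddle (hγ : 0 < γ) :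
    Tendsto (fun N : ℕ => Real.log N / 2 / Real.log (1 / saddle γ N)) atTop (𝓝 1) := by
  have hlog : Tendsto (fun N : ℕ => Real.log (N : ℝ)) atTop atTop :=
    Real.tendsto_log_atTop.comp tendsto_natCast_atTop_atTop
  have h : Tendsto (fun N : ℕ => (1 - Real.log γ / Real.log (N : ℝ))⁻¹) atTop (𝓝 (1 - 0)⁻¹) :=
    ((tendsto_const_nhds.div_atTop hlog).const_sub 1).inv₀ (by norm_num)
  rw [sub_zero, inv_one] at h
  refine h.congr' ?_
  filter_upwards [eventually_gt_atTop 0, hlog.eventually (eventually_gt_atTop 0)] with N hN hl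
  have hNr0 : (0 : ℝ) < N := by exact_mod_cast hN
  have e : Real.log (1 / saddle γ N) = (Real.log N - Real.log γ) / 2 := by
    rw [one_div, Real.log_inv, saddle, Real.log_sqrt (by positivity),
      Real.log_div hγ.ne' hNr0.ne']
    ring
  rw [e, div_div_div_cancel_right₀ two_ne_zero, ← inv_div (_ - _), sub_div, div_self hl.ne']

lemma tendsto_partialSumAsymptotic_div_saddleScale {b : ℕ → ℝ} {lam α β : ℝ} (hγ : 0 < γ)
    (hlam : 0 < lam)
    (hB : Tendsto (fun t => realGenFun b t / growth α β γ t) (𝓝[>] 0) (𝓝 lam)) :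
    Tendsto (fun N => partialSumAsymptotic lam α β γ N / saddleScale b γ N) atTop
      (𝓝 (1 / (2 * Real.sqrt (Real.pi * γ)))) := by
  have htw : Tendsto (saddle γ) atTop (𝓝[>] 0) := by
    refine tendsto_nhdsWithin_iff.2 ⟨tendsto_saddle γ, ?_⟩
    filter_upwards [eventually_gt_atTop 0] with N hN using saddle_pos hγ hN
  have h1 := (((tendsto_log_div_log_saddle hγ).rpow_const (p := α) (Or.inl one_ne_zero)).const_mul
    (1 / (2 * Real.sqrt (Real.pi * γ)) * lam)).div (hB.comp htw) hlam.ne'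
  rw [Real.one_rpow, mul_one, mul_div_cancel_right₀ _ hlam.ne'] at h1
  refine h1.congr' ?_
  filter_upwards [eventually_gt_atTop 1, (tendsto_saddle γ).eventually (gt_mem_nhds one_pos)]
    with N hN ht1
  have ht := saddle_pos hγ (show 0 < N by omega)
  rw [partialSumAsymptotic_eq hγ hN ht1, saddleScale]
  have hs : Real.sqrt (saddle γ N) ≠ 0 := (Real.sqrt_pos.2 ht).ne'
  have hg := (growth_pos (α := α) (β := β) (γ := γ) ht ht1).ne'
  have he := (Real.exp_pos (γ / saddle γ N)).ne'
  simp only [Pi.div_apply, Function.comp]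
  by_cases h0 : realGenFun b (saddle γ N) = 0
  · simp [h0]
  · field_simp

end Saddle

/-! ### From partial sums to monotone coefficients -/

section Monotone

variable {b : ℕ → ℝ}

lemma partialSum_natCast (b : ℕ → ℝ) (N : ℕ) :
    partialSum b N = ∑ n ∈ Finset.range (N + 1), b n := by
  rw [partialSum, Nat.floor_natCast]

lemma mul_le_partialSum_add_sub (hb : ∀ n, 0 ≤ b n) (hm : Monotone b) (N : ℕ) {y : ℝ}
    (hy : 0 ≤ y) : b N * (y - 1) ≤ partialSum b (N + y) - partialSum b N := by
  have e : ⌊(N : ℝ) + y⌋₊ + 1 = (N + 1) + ⌊y⌋₊ := by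
    rw [add_comm (N : ℝ), Nat.floor_add_natCast hy]; ring
  rw [partialSum_natCast, partialSum, e, Finset.sum_range_add, add_sub_cancel_left]
  calc b N * (y - 1) ≤ b N * ⌊y⌋₊ :=
        mul_le_mul_of_nonneg_left (by linarith [Nat.lt_floor_add_one y]) (hb N)
    _ = ∑ _i ∈ Finset.range ⌊y⌋₊, b N := by simp [mul_comm]
    _ ≤ _ := Finset.sum_le_sum fun i _ => hm (by omega)

lemma partialSum_sub_le_mul (hb : ∀ n, 0 ≤ b n) (hm : Monotone b) (N : ℕ) {y : ℝ}
    (hy : 0 ≤ y) (hyN : y ≤ N) : partialSum b N - partialSum b (N - y) ≤ b N * (y + 1) := by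
  obtain ⟨m, hmdef⟩ : ∃ m, ⌊(N : ℝ) - y⌋₊ = m := ⟨_, rfl⟩
  have h1 : (m : ℝ) ≤ N - y := hmdef ▸ Nat.floor_le (by linarith)
  have h2 : (N : ℝ) - y < m + 1 := hmdef ▸ Nat.lt_floor_add_one _
  have hmN : m ≤ N := by exact_mod_cast (by linarith : (m : ℝ) ≤ N)
  obtain ⟨j, rfl⟩ := Nat.exists_eq_add_of_le hmN
  rw [partialSum_natCast, partialSum, hmdef, show m + j + 1 = m + 1 + j by ring,
    Finset.sum_range_add, add_sub_cancel_left]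
  push_cast at h2
  calc ∑ i ∈ Finset.range j, b (m + 1 + i) ≤ ∑ _i ∈ Finset.range j, b (m + j) :=
        Finset.sum_le_sum fun i hi => hm (by have := Finset.mem_range.1 hi; omega)
    _ = b (m + j) * j := by simp [mul_comm]
    _ ≤ _ := mul_le_mul_of_nonneg_left (by linarith) (hb _)

lemma tendsto_exp_sub_one_div : Tendsto (fun δ : ℝ => (Real.exp δ - 1) / δ) (𝓝[≠] 0) (𝓝 1) := by
  have h := hasDerivAt_iff_tendsto_slope.1 (Real.hasDerivAt_exp 0)
  rw [Real.exp_zero] at h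
  refine h.congr fun δ => ?_
  rw [slope_def_field, Real.exp_zero, sub_zero]

/-- If the partial sums up to `N + δ/t`, divided by `E N`, converge to `c e^δ` for every `δ`, then a
monotone sequence is of size `c t E` at `N`: compare `b N` with its mean over the windows of length
`δ / t` on either side of `N`, and let `δ` tend to zero. -/
lemma tendsto_div_of_tendsto_partialSum (hb : ∀ n, 0 ≤ b n) (hm : Monotone b) {t E : ℕ → ℝ} {c : ℝ}
    (hc : 0 < c) (ht : ∀ᶠ N in atTop, 0 < t N) (ht0 : Tendsto t atTop (𝓝 0))
    (hNt : Tendsto (fun N : ℕ => N * t N) atTop atTop) (hE : ∀ᶠ N in atTop, 0 < E N)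
    (h : ∀ δ : ℝ, Tendsto (fun N : ℕ => partialSum b (N + δ / t N) / E N) atTop
      (𝓝 (c * Real.exp δ))) :
    Tendsto (fun N => b N / (t N * E N)) atTop (𝓝 c) := by
  have h0 : Tendsto (fun N : ℕ => partialSum b N / E N) atTop (𝓝 c) := by simpa using h 0
  have hlim : Tendsto (fun δ : ℝ => c * ((Real.exp δ - 1) / δ)) (𝓝[≠] 0) (𝓝 c) := by
    simpa using tendsto_exp_sub_one_div.const_mul c
  rw [tendsto_order]
  constructor
  · intro a ha
    obtain ⟨δ, h1, h2⟩ := (((hlim.mono_left (nhdsLT_le_nhdsNE 0)).eventually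
      (lt_mem_nhds ha)).and self_mem_nhdsWithin).exists
    have h2 : δ < 0 := h2
    have hq : Tendsto (fun N : ℕ => (partialSum b N / E N - partialSum b (N + δ / t N) / E N) /
        (-δ + t N)) atTop (𝓝 ((c - c * Real.exp δ) / (-δ + 0))) :=
      (h0.sub (h δ)).div (ht0.const_add _) (by linarith)
    have e : (c - c * Real.exp δ) / (-δ + 0) = c * ((Real.exp δ - 1) / δ) := by
      have := h2.ne
      rw [add_zero]; field_simp; ring
    rw [e] at hq
    filter_upwards [hq.eventually (lt_mem_nhds h1), ht, hE,
      hNt.eventually (eventually_ge_atTop (-δ))] with N hN htN hEN hNtN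
    refine hN.trans_le ?_
    have hyN : -δ / t N ≤ N := (div_le_iff₀ htN).2 hNtN
    have hb1 := partialSum_sub_le_mul hb hm N (y := -δ / t N)
      (div_nonneg (by linarith) htN.le) hyN
    rw [show (N : ℝ) - -δ / t N = N + δ / t N by ring] at hb1
    rw [← sub_div, div_div, div_le_div_iff₀ (mul_pos hEN (by linarith)) (by positivity)]
    calc _ ≤ b N * (-δ / t N + 1) * (t N * E N) := by gcongr
      _ = _ := by field_simp
  · intro a ha
    obtain ⟨δ, h1, h2⟩ := (((hlim.mono_left (nhdsGT_le_nhdsNE 0)).eventually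
      (gt_mem_nhds ha)).and self_mem_nhdsWithin).exists
    have h2 : 0 < δ := h2
    have hq : Tendsto (fun N : ℕ => (partialSum b (N + δ / t N) / E N - partialSum b N / E N) /
        (δ - t N)) atTop (𝓝 ((c * Real.exp δ - c) / (δ - 0))) :=
      ((h δ).sub h0).div (ht0.const_sub _) (by linarith)
    have e : (c * Real.exp δ - c) / (δ - 0) = c * ((Real.exp δ - 1) / δ) := by
      rw [sub_zero]; ring
    rw [e] at hq
    filter_upwards [hq.eventually (gt_mem_nhds h1), ht, hE,
      ht0.eventually (gt_mem_nhds h2)] with N hN htN hEN htδ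
    refine lt_of_le_of_lt ?_ hN
    have hb1 := mul_le_partialSum_add_sub hb hm N (y := δ / t N) (div_nonneg h2.le htN.le)
    rw [← sub_div, div_div, div_le_div_iff₀ (by positivity) (mul_pos hEN (by linarith))]
    calc b N * (E N * (δ - t N)) = b N * (δ / t N - 1) * (t N * E N) := by field_simp
      _ ≤ _ := by gcongr

end Monotone

/-! ### The Tauberian theorem -/

section Tauberian

variable {b : ℕ → ℝ} {lam α β γ : ℝ}

lemma tendsto_realGenFun_div_growth (hlam : lam ≠ 0)
    (hreal : (fun t : ℝ => genFun b (Complex.exp (-(t : ℂ)))) ~[𝓝[>] (0 : ℝ)]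
      (fun t : ℝ => ((lam * Real.log (1 / t) ^ α * t ^ β * Real.exp (γ / t) : ℝ) : ℂ))) :
    Tendsto (fun t => realGenFun b t / growth α β γ t) (𝓝[>] 0) (𝓝 lam) := by
  have hid : Tendsto (fun t : ℝ => t) (𝓝[>] 0) (𝓝 0) := nhdsWithin_le_nhds
  have hgrow : ∀ᶠ t in 𝓝[>] (0 : ℝ), 0 < growth α β γ t := by
    filter_upwards [self_mem_nhdsWithin, hid.eventually (gt_mem_nhds one_pos)] with t ht h1
    exact growth_pos ht h1
  have hmain : ∀ t : ℝ, lam * Real.log (1 / t) ^ α * t ^ β * Real.exp (γ / t)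
      = lam * growth α β γ t := fun t => by unfold growth; ring
  simp_rw [hmain, genFun_exp_neg_ofReal] at hreal
  have h1 := (isEquivalent_iff_tendsto_one (by
    filter_upwards [hgrow] with t ht
    exact_mod_cast mul_ne_zero hlam ht.ne')).1 hreal
  have h2 := ((Complex.continuous_re.tendsto _).comp h1).const_mul lam
  rw [Complex.one_re, mul_one] at h2
  refine h2.congr' ?_
  filter_upwards [hgrow] with t ht
  simp only [Function.comp, Pi.div_apply, ← Complex.ofReal_div, Complex.ofReal_re]
  field_simp

lemma eq_zero_of_isEquivalent_zero (hb : ∀ n, 0 ≤ b n) (hrad : 1 ≤ radiusOfConvergence b)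
    (h : (fun t : ℝ => genFun b (Complex.exp (-(t : ℂ)))) ~[𝓝[>] (0 : ℝ)] 0) : b = 0 := by
  obtain ⟨t, ht, htpos⟩ :=
    ((isEquivalent_zero_iff_eventually_zero.1 h).and self_mem_nhdsWithin).exists
  have htpos : 0 < t := htpos
  simp only [genFun_exp_neg_ofReal, Pi.zero_apply, Complex.ofReal_eq_zero] at ht
  ext n
  have h1 := (hasSum_zero_iff_of_nonneg (fun n => mul_nonneg (hb n) (Real.exp_pos _).le)).1
    (ht ▸ (summable_mul_exp hb hrad htpos).hasSum :
      HasSum (fun n : ℕ => b n * Real.exp (-(n * t))) 0)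
  simpa using congrFun h1 n

lemma tendsto_partialSum_div_saddleScale (hb : ∀ n, 0 ≤ b n) (hrad : 1 ≤ radiusOfConvergence b)
    (hγ : 0 < γ) (hlam : 0 < lam)
    (hB : Tendsto (fun t => realGenFun b t / growth α β γ t) (𝓝[>] 0) (𝓝 lam))
    (hcone : ∀ Δ : ℝ, 0 < Δ →
      (fun z : ℂ => genFun b (Complex.exp (-z))) =O[𝓝[cone Δ] (0 : ℂ)]
        (fun z : ℂ => growth α β γ ‖z‖)) (δ : ℝ) :
    Tendsto (fun N : ℕ => partialSum b (N + δ / saddle γ N) / saddleScale b γ N) atTop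
      (𝓝 (1 / (2 * Real.sqrt (Real.pi * γ)) * Real.exp δ)) := by
  rw [← tendsto_add_atTop_iff_nat 1, one_div_mul_eq_div]
  refine (tendsto_partialSum_saddle hb hrad hγ hlam hB hcone
    (t := fun k => saddle γ (k + 1)) (fun k => saddle_pos hγ k.succ_pos)
    ((tendsto_add_atTop_iff_nat 1).2 (tendsto_saddle γ)) δ).congr fun k => ?_
  rw [add_div, div_saddle_div_saddle hγ k.succ_pos, saddleScale]

lemma eventually_saddleScale_pos (hγ : 0 < γ) (hlam : 0 < lam)
    (hB : Tendsto (fun t => realGenFun b t / growth α β γ t) (𝓝[>] 0) (𝓝 lam)) :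
    ∀ᶠ N in atTop, 0 < saddleScale b γ N := by
  have htw : Tendsto (saddle γ) atTop (𝓝[>] 0) := by
    refine tendsto_nhdsWithin_iff.2 ⟨tendsto_saddle γ, ?_⟩
    filter_upwards [eventually_gt_atTop 0] with N hN using saddle_pos hγ hN
  filter_upwards [(hB.comp htw).eventually (lt_mem_nhds hlam), eventually_gt_atTop 0,
    (tendsto_saddle γ).eventually (gt_mem_nhds one_pos)] with N h1 hN ht1
  have ht := saddle_pos hγ hN
  have hg := growth_pos (α := α) (β := β) (γ := γ) ht ht1
  have h2 : 0 < realGenFun b (saddle γ N) := by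
    have := mul_pos h1 hg
    rwa [Function.comp, div_mul_cancel₀ _ hg.ne'] at this
  unfold saddleScale
  positivity

lemma tendsto_natCast_mul_saddle (hγ : 0 < γ) :
    Tendsto (fun N : ℕ => N * saddle γ N) atTop atTop := by
  have h : Tendsto (fun N : ℕ => Real.sqrt (γ * N)) atTop atTop :=
    Real.tendsto_sqrt_atTop.comp (tendsto_natCast_atTop_atTop.const_mul_atTop hγ)
  refine h.congr' ?_
  filter_upwards [eventually_gt_atTop 0] with N hN
  have ht := saddle_pos hγ hN
  rw [← div_saddle hγ hN, ← div_mul_cancel₀ (γ / saddle γ N) ht.ne', div_saddle_div_saddle hγ hN]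

lemma isEquivalent_of_tendsto_div {u v E : ℕ → ℝ} {c : ℝ} (hc : c ≠ 0)
    (hE : ∀ᶠ N in atTop, E N ≠ 0) (hu : Tendsto (fun N => u N / E N) atTop (𝓝 c))
    (hv : Tendsto (fun N => v N / E N) atTop (𝓝 c)) : u ~[atTop] v := by
  refine isEquivalent_of_tendsto_one ?_
  have h := hu.div hv hc
  rw [div_self hc] at h
  refine h.congr' ?_
  filter_upwards [hE] with N hN
  simp only [Pi.div_apply]
  rw [div_div_div_cancel_right₀ hN]

end Tauberian

theorem theorem1p1 (b : ℕ → ℝ) (hb : ∀ n, 0 ≤ b n)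
    (hrad : 1 ≤ radiusOfConvergence b)
    (lam α β γ : ℝ) (hγ : 0 < γ)
    (hreal : (fun t : ℝ => genFun b (Complex.exp (-(t : ℂ)))) ~[𝓝[>] (0 : ℝ)]
      (fun t : ℝ => ((lam * Real.log (1 / t) ^ α * t ^ β * Real.exp (γ / t) : ℝ) : ℂ)))
    (hcone : ∀ Δ : ℝ, 0 < Δ →
      (fun z : ℂ => genFun b (Complex.exp (-z))) =O[𝓝[cone Δ] (0 : ℂ)]
        (fun z : ℂ => Real.log (1 / ‖z‖) ^ α * ‖z‖ ^ β * Real.exp (γ / ‖z‖))) :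
    ((fun N : ℕ => ∑ n ∈ Finset.range (N + 1), b n) ~[atTop]
      (fun N : ℕ => lam * γ ^ (β / 2 - 1 / 4) * Real.log (N : ℝ) ^ α /
        ((2 : ℝ) ^ (α + 1) * Real.sqrt Real.pi * (N : ℝ) ^ (β / 2 + 1 / 4)) *
          Real.exp (2 * Real.sqrt (γ * N)))) ∧
    (Monotone b →
      (b ~[atTop]
        (fun n : ℕ => lam * γ ^ (β / 2 + 1 / 4) * Real.log (n : ℝ) ^ α /
          ((2 : ℝ) ^ (α + 1) * Real.sqrt Real.pi * (n : ℝ) ^ (β / 2 + 3 / 4)) *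
            Real.exp (2 * Real.sqrt (γ * n))))) := by
  rcases eq_or_ne lam 0 with rfl | hlam0
  · have hz : b = 0 := eq_zero_of_isEquivalent_zero hb hrad (by simpa using! hreal)
    subst hz
    refine ⟨?_, fun _ => ?_⟩
    · exact (IsEquivalent.refl (u := fun _ : ℕ => (0 : ℝ))).congr_left (by simp) |>.congr_right
        (by simp)
    · exact (IsEquivalent.refl (u := fun _ : ℕ => (0 : ℝ))).congr_right (by simp)
  have hB := tendsto_realGenFun_div_growth hlam0 hreal
  have hlam : 0 < lam := by
    refine lt_of_le_of_ne (ge_of_tendsto hB ?_) hlam0.symm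
    have hid : Tendsto (fun t : ℝ => t) (𝓝[>] 0) (𝓝 0) := nhdsWithin_le_nhds
    filter_upwards [self_mem_nhdsWithin, hid.eventually (gt_mem_nhds one_pos)] with t ht h1
    exact div_nonneg (realGenFun_nonneg hb t) (growth_pos ht h1).le
  have hc : 0 < 1 / (2 * Real.sqrt (Real.pi * γ)) := by positivity
  have hE := eventually_saddleScale_pos hγ hlam hB
  have hS := tendsto_partialSum_div_saddleScale hb hrad hγ hlam hB hcone
  have hA := tendsto_partialSumAsymptotic_div_saddleScale hγ hlam hB
  refine ⟨?_, fun hm => ?_⟩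
  · refine isEquivalent_of_tendsto_div hc.ne' (hE.mono fun N h => h.ne') ?_ hA
    simpa [partialSum_natCast] using hS 0
  · have ht : ∀ᶠ N in atTop, 0 < saddle γ N := by
      filter_upwards [eventually_gt_atTop 0] with N hN using saddle_pos hγ hN
    have hbN := tendsto_div_of_tendsto_partialSum hb hm hc ht (tendsto_saddle γ)
      (tendsto_natCast_mul_saddle hγ) hE hS
    refine isEquivalent_of_tendsto_div hc.ne' (E := fun N => saddle γ N * saddleScale b γ N)
      ((ht.and hE).mono fun N h => (mul_pos h.1 h.2).ne') hbN (hA.congr' ?_)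
    filter_upwards [eventually_gt_atTop 0, hE] with N hN hEN
    have hNr0 : (0 : ℝ) < N := by exact_mod_cast hN
    have htN := saddle_pos hγ hN
    have e1 : γ ^ (β / 2 + 1 / 4) = γ ^ (β / 2 - 1 / 4) * Real.sqrt γ := by
      rw [Real.sqrt_eq_rpow, ← Real.rpow_add hγ]; congr 1; ring
    have e2 : (N : ℝ) ^ (β / 2 + 3 / 4) = (N : ℝ) ^ (β / 2 + 1 / 4) * Real.sqrt N := by
      rw [Real.sqrt_eq_rpow, ← Real.rpow_add hNr0]; congr 1; ring
    have e3 : saddle γ N = Real.sqrt γ / Real.sqrt N := Real.sqrt_div hγ.le _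
    rw [e1, e2, partialSumAsymptotic, e3]
    have h1 : Real.sqrt γ ≠ 0 := (Real.sqrt_pos.2 hγ).ne'
    have h2 : Real.sqrt (N : ℝ) ≠ 0 := (Real.sqrt_pos.2 hNr0).ne'
    have h3 := (Real.rpow_pos_of_pos hNr0 (β / 2 + 1 / 4)).ne'
    have h4 := (Real.rpow_pos_of_pos (two_pos (α := ℝ)) (α + 1)).ne'
    have h5 : Real.sqrt Real.pi ≠ 0 := (Real.sqrt_pos.2 Real.pi_pos).ne'
    have h6 := hEN.ne'
    field_simp
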